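/- Let $K/k$ be a finite Galois extension of global fields with Galois group $G$ (not necessarily cyclic). Let $S$ be a finite non-empty set of places of $k$ containing all archimedean places, let $\mathcal O_{k,S}$ be the ring of $S$-integers of $k$, and let $\mathfrak m=\mathfrak m_f\mathfrak m_\infty$ be a modulus of $k$ whose finite part is prime to $S$: $\mathfrak m_f$ is a nonzero ideal of $\mathcal O_{k,S}$, and $\mathfrak m_\infty$ is a formal product of distinct real places of $k$ (empty in the function field case). Let $S(\mathfrak m)$ be the set of places of $k$ dividing $\mathfrak m$. For a global field $F$, a finite non-empty set $S$ of places of $F$ containing the archimedean ones, and such a modulus $\mathfrak m$ of $F$, let $F^{\mathfrak m}$ be the group of all $x\in F^\times$ with $x\in 1+\mathfrak m_f\mathcal O_w$ for every finite place $w\mid\mathfrak m_f$ and $w(x)>0$ for every real place $w\mid\mathfrak m_\infty$. Let $E^{\mathfrak m}_{F,S}=\mathcal O_{F,S}^\times\cap F^{\mathfrak m}$, and let $$\mathrm{Cl}^{\mathfrak m}_{F,S}=I_F^{S(\mathfrak m)\cup S}\big/\Big\{\textstyle\sum_{w\notin S}\mathrm{ord}_w(x)\,w : x\in F^{\mathfrak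 m}\Big\},$$ where $I_F^{S(\mathfrak m)\cup S}$ is the free abelian group on the finite places of $F$ outside $S\cup S(\mathfrak m)$. Let $S_K$ be the set of places of $K$ over $S$, and let $\mathfrak m_K$ be the modulus of $K$ with finite part $\mathfrak m_f\mathcal O_{K,S_K}$ and infinite part the product of the real places of $K$ lying over places dividing $\mathfrak m_\infty$. Write $K^{\mathfrak m}$, $E^{\mathfrak m}_{K,S}$, $\mathrm{Cl}^{\mathfrak m}_{K,S}$ for $K^{\mathfrak m_K}$, $E^{\mathfrak m_K}_{K,S_K}$, $\mathrm{Cl}^{\mathfrak m_K}_{K,S_K}$; these are $G$-modules. Let $\mathfrak m_r$ be the modulus of $k$ obtained from $\mathfrak m$ by keeping $\mathfrak m_f$ and only those real places dividing $\mathfrak m_\infty$ that stay real in $K$. For a finite place $v$ of $k$ let $e_v$ be its ramification index in $K/k$. Then the groups $\mathrm{Cl}^{\mathfrak m}_{K,S}$, $\mathrm{Cl}^{\mathfrak m_r}_{k,S}$, $H^1(G,E^{\mathfrak m}_{K,S})$, $H^2(G,E^{\mathfrak m}_{K,S})$ and $H^1(G,K^{\mathfrak m})$ are finite, $e_v=1$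 for all but finitely many $v\notin S\cup S(\mathfrak m)$, and $$\frac{|(\mathrm{Cl}^{\mathfrak m}_{K,S})^G|}{|\mathrm{Cl}^{\mathfrak m_r}_{k,S}|} =\frac{|H^2(G,E^{\mathfrak m}_{K,S})|}{|H^1(G,E^{\mathfrak m}_{K,S})|}\cdot \frac{\prod_{v\notin S\cup S(\mathfrak m)}e_v\cdot|H^1(G,K^{\mathfrak m})|}{\big|\mathrm{Im}\{H^2(G,E^{\mathfrak m}_{K,S})\to H^2(G,K^{\mathfrak m})\}\big|},$$ where the map on $H^2$ is induced by the inclusion $E^{\mathfrak m}_{K,S}\subset K^{\mathfrak m}$. -/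

import Mathlib

open scoped Pointwise

noncomputable section

namespace RayClass

/-- A global field: a number field, or a finite extension of `𝔽_p(t)` for some prime `p`. -/
def IsGlobalField (F : Type*) [Field F] : Prop :=
  NumberField F ∨
    ∃ (p : ℕ) (_ : Fact p.Prime) (_ : Algebra (RatFunc (ZMod p)) F),
      FiniteDimensional (RatFunc (ZMod p)) F

/-! ### Places -/

/-- A finite (non-archimedean) place of `F`, given by its valuation ring in `F`, which is a
discrete valuation ring with field of fractions `F`. -/
@[ext]
structure FinitePlace (F : Type*) [Field F] where
  /-- the valuation ring of the place -/
  ring : ValuationSubring F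
  isDVR : IsDiscreteValuationRing ring

attribute [instance] FinitePlace.isDVR

/-- The places of `F`: the finite ones and the archimedean ones. -/
abbrev Place (F : Type*) [Field F] : Type _ :=
  FinitePlace F ⊕ NumberField.InfinitePlace F

/-- The normalized additive valuation `ord_w : Fˣ → ℤ` of a finite place, written as a
homomorphism to `Multiplicative ℤ`; it is `1` on uniformizers. (Mathlib's `valuationOfNeZero` is
the inverse of it: it is `-1` on uniformizers.) -/
def FinitePlace.ordHom {F : Type*} [Field F] (w : FinitePlace F) : Fˣ →* Multiplicative ℤ :=
  ((IsDiscreteValuationRing.maximalIdeal w.ring).valuationOfNeZero)⁻¹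

/-- The normalized additive valuation `ord_w(x) ∈ ℤ` of a nonzero element `x`. -/
def FinitePlace.ord {F : Type*} [Field F] (w : FinitePlace F) (x : Fˣ) : ℤ :=
  (w.ordHom x).toAdd

/-! ### `S`-integers and `S`-moduli -/

section SModulus

variable {F : Type*} [Field F]

/-- The ring `O_{F,S}` of `S`-integers: the elements that lie in `O_w` for all finite `w ∉ S`
(`S` is always a set of places that contains the archimedean ones). -/
def sIntegers (S : Set (Place F)) : Subring F where
  carrier := {a | ∀ w : FinitePlace F, Sum.inl w ∉ S → a ∈ w.ring}
  mul_mem' ha hb w hw := mul_mem (ha w hw) (hb w hw)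
  one_mem' w _ := one_mem w.ring
  add_mem' ha hb w hw := add_mem (ha w hw) (hb w hw)
  zero_mem' w _ := zero_mem w.ring
  neg_mem' ha w hw := neg_mem (ha w hw)

/-- The group of `S`-units: the nonzero `x` with both `x` and `x⁻¹` in `O_{F,S}`. -/
def sUnits (S : Set (Place F)) : Subgroup Fˣ where
  carrier := {x | (x : F) ∈ sIntegers S ∧ ((x⁻¹ : Fˣ) : F) ∈ sIntegers S}
  mul_mem' {x y} hx hy := by
    refine ⟨?_, ?_⟩
    · rw [Units.val_mul]; exact mul_mem hx.1 hy.1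
    · rw [mul_inv, Units.val_mul]; exact mul_mem hx.2 hy.2
  one_mem' := by
    refine ⟨?_, ?_⟩
    · rw [Units.val_one]; exact one_mem _
    · rw [inv_one, Units.val_one]; exact one_mem _
  inv_mem' {x} hx := ⟨hx.2, by rw [inv_inv]; exact hx.1⟩

/-- An `S`-modulus `𝔪 = 𝔪_∞ 𝔪_f`: a nonzero ideal `𝔪_f` of `O_{F,S}` together with a set of
real places. -/
structure SModulus (S : Set (Place F)) where
  /-- the finite part `𝔪_f` -/
  fin : Ideal (sIntegers S)
  fin_ne_bot : fin ≠ ⊥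
  /-- the real places that divide `𝔪_∞` -/
  inf : Set (NumberField.InfinitePlace F)
  isReal : ∀ w ∈ inf, w.IsReal

namespace SModulus

variable {S : Set (Place F)} (m : SModulus S)

/-- The finite place `w` divides `𝔪_f`: it is outside `S`, and `𝔪_f` is contained in the maximal
ideal of `O_w`. -/
def FinDvd (w : FinitePlace F) : Prop :=
  Sum.inl w ∉ S ∧ ∀ a ∈ m.fin, (a : F) ∈ w.ring.nonunits

/-- The support `S(𝔪)` of the modulus. -/
def support : Set (Place F) :=
  {w | Sum.elim m.FinDvd (fun w => w ∈ m.inf) w}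

/-- The ideal `𝔪_f O_w`, as an `O_w`-submodule of `F`. -/
def localIdeal (w : FinitePlace F) : Submodule w.ring F :=
  Submodule.span w.ring (Subtype.val '' (m.fin : Set (sIntegers S)))

theorem localIdeal_le {w : FinitePlace F} (hw : m.FinDvd w) {x : F} (hx : x ∈ m.localIdeal w) :
    x ∈ w.ring.nonunits := by
  rw [ValuationSubring.mem_nonunits_iff]
  induction hx using Submodule.span_induction with
  | mem x hx =>
    obtain ⟨a, ha, rfl⟩ := hx
    exact (ValuationSubring.mem_nonunits_iff _).1 (hw.2 a ha)
  | zero => simp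
  | add x y _ _ hx hy => exact Valuation.map_add_lt _ hx hy
  | smul a x _ hx =>
    have ha : w.ring.valuation (a : F) ≤ 1 := (ValuationSubring.valuation_le_one_iff _ _).2 a.2
    rw [show a • x = (a : F) * x from rfl, map_mul]
    exact mul_lt_one_of_nonneg_of_lt_one_right ha zero_le hx

theorem mem_ring_of_sub_one_mem {w : FinitePlace F} (hw : m.FinDvd w) {x : F}
    (hx : x - 1 ∈ m.localIdeal w) : x ∈ w.ring := by
  have := add_mem (w.ring.nonunits_subset (m.localIdeal_le hw hx)) (one_mem w.ring)
  rwa [sub_add_cancel] at this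

theorem inv_mem_ring_of_sub_one_mem {w : FinitePlace F} (hw : m.FinDvd w) {x : F}
    (hx : x - 1 ∈ m.localIdeal w) : x⁻¹ ∈ w.ring := by
  have h := (ValuationSubring.mem_nonunits_iff _).1 (m.localIdeal_le hw hx)
  have h1 : w.ring.valuation x = 1 := by
    have := Valuation.map_one_add_of_lt w.ring.valuation h
    rwa [add_sub_cancel] at this
  rw [← ValuationSubring.valuation_le_one_iff, map_inv₀, h1, inv_one]

/-- The group `F^𝔪` of the `x ∈ Fˣ` with `x ≡ 1 mod 𝔪_f`, that is `x ∈ 1 + 𝔪_f O_w` for all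
`w ∣ 𝔪_f`, and `w(x) > 0` for each real place `w ∣ 𝔪_∞`. -/
def rayGroup : Subgroup Fˣ where
  carrier := {x | (∀ w, m.FinDvd w → (x : F) - 1 ∈ m.localIdeal w) ∧
    ∀ (w : NumberField.InfinitePlace F) (hw : w ∈ m.inf),
      0 < NumberField.InfinitePlace.embedding_of_isReal (m.isReal w hw) (x : F)}
  one_mem' := ⟨fun w _ => by simp, fun w hw => by simp⟩
  mul_mem' {x y} hx hy := by
    refine ⟨fun w hw => ?_, fun w hw => ?_⟩
    · have h : ((x * y : Fˣ) : F) - 1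
          = (⟨x, m.mem_ring_of_sub_one_mem hw (hx.1 w hw)⟩ : w.ring) • ((y : F) - 1)
            + ((x : F) - 1) := by
        rw [show ∀ (a : w.ring) (z : F), a • z = (a : F) * z from fun _ _ => rfl]
        push_cast
        ring
      rw [h]
      exact add_mem (Submodule.smul_mem _ _ (hy.1 w hw)) (hx.1 w hw)
    · rw [Units.val_mul, map_mul]
      exact mul_pos (hx.2 w hw) (hy.2 w hw)
  inv_mem' {x} hx := by
    refine ⟨fun w hw => ?_, fun w hw => ?_⟩
    · have h : ((x⁻¹ : Fˣ) : F) - 1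
          = -((⟨(x : F)⁻¹, m.inv_mem_ring_of_sub_one_mem hw (hx.1 w hw)⟩ : w.ring)
            • ((x : F) - 1)) := by
        rw [show ∀ (a : w.ring) (z : F), a • z = (a : F) * z from fun _ _ => rfl]
        have := x.ne_zero
        push_cast
        field_simp
        ring
      rw [h]
      exact neg_mem (Submodule.smul_mem _ _ (hx.1 w hw))
    · rw [Units.val_inv_eq_inv_val, map_inv₀]
      exact inv_pos.2 (hx.2 w hw)

/-- The group `E^𝔪_{F,S}`: the `S`-units that lie in `F^𝔪`. -/
def unitGroup : Subgroup Fˣ := sUnits S ⊓ m.rayGroup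

/-- The group `I_F^{S(𝔪) ∪ S}`: the free abelian group on the finite places outside
`S ∪ S(𝔪)`, as a subgroup of the group of all divisors. -/
def divisorGroup : AddSubgroup (FinitePlace F →₀ ℤ) where
  carrier := {D | ∀ w : FinitePlace F, Sum.inl w ∈ S ∪ m.support → D w = 0}
  add_mem' ha hb w hw := by rw [Finsupp.add_apply, ha w hw, hb w hw, add_zero]
  zero_mem' _ _ := rfl
  neg_mem' ha w hw := by rw [Finsupp.neg_apply, ha w hw, neg_zero]

/-- The group `P_F^{𝔪,S}` of the principal divisors `div^S(x) = ∑_{w ∉ S} ord_w(x) w` with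
`x ∈ F^𝔪`, as a subgroup of `I_F^{S(𝔪) ∪ S}`. -/
def principalDivisors : AddSubgroup m.divisorGroup where
  carrier := {D | ∃ x ∈ m.rayGroup, ∀ w : FinitePlace F, Sum.inl w ∉ S → D.1 w = w.ord x}
  add_mem' := by
    rintro a b ⟨x, hx, hax⟩ ⟨y, hy, hby⟩
    refine ⟨x * y, mul_mem hx hy, fun w hw => ?_⟩
    simp [FinitePlace.ord, hax w hw, hby w hw]
  zero_mem' := ⟨1, one_mem _, fun w _ => by simp [FinitePlace.ord]⟩
  neg_mem' := by
    rintro a ⟨x, hx, hax⟩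
    exact ⟨x⁻¹, inv_mem hx, fun w hw => by simp [FinitePlace.ord, hax w hw]⟩

/-- The `S`-ray class group `Cl^𝔪_{F,S} = I_F^{S(𝔪) ∪ S} / P_F^{𝔪,S}`. -/
abbrev ClassGroup : Type _ := m.divisorGroup ⧸ m.principalDivisors

end SModulus

end SModulus

/-! ### Extensions -/

section Extension

variable {k K : Type*} [Field k] [Field K] [Algebra k K]

/-- The place `w` of `K` lies over the place `v` of `k`. -/
def LiesOver : Place K → Place k → Prop
  | Sum.inl w, Sum.inl v => w.ring.comap (algebraMap k K) = v.ring
  | Sum.inr w, Sum.inr v => w.comap (algebraMap k K) = v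
  | _, _ => False

variable (K) in
/-- The set `S_K` of the places of `K` over `S`. -/
def placesOver (S : Set (Place k)) : Set (Place K) :=
  {w | ∃ v ∈ S, LiesOver w v}

variable (k) in
/-- The ramification index over `k` of a finite place `w` of `K`: the index of the value group
`ord_w(kˣ)` in `ord_w(Kˣ) = ℤ`. -/
def ramificationIndexAt (w : FinitePlace K) : ℕ :=
  (w.ordHom.comp (Units.map (algebraMap k K : k →* K))).range.index

open Classical in
variable (K) in
/-- The ramification index `e_v` in `K/k` of a finite place `v` of `k`: the ramification index of
some place `w` of `K` over `v`. (In a finite extension there always is such a `w`, and in a Galois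
extension `e_v` does not depend on it.) -/
def ramificationIndex (v : FinitePlace k) : ℕ :=
  if h : ∃ w : FinitePlace K, LiesOver (Sum.inl w) (Sum.inl v) then
    ramificationIndexAt k h.choose
  else 1

theorem FinitePlace.valuation_le_one_iff {F : Type*} [Field F] (w : FinitePlace F) (x : F) :
    (IsDiscreteValuationRing.maximalIdeal w.ring).valuation F x ≤ 1 ↔ x ∈ w.ring := by
  constructor
  · intro h
    obtain ⟨a, rfl⟩ := IsDiscreteValuationRing.exists_lift_of_le_one h
    exact a.2
  · intro h
    exact (IsDiscreteValuationRing.maximalIdeal w.ring).valuation_le_one (⟨x, h⟩ : w.ring)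

/-- The restriction to `k` of a finite place of `K` is a finite place or trivial. -/
theorem FinitePlace.isDVR_comap (w : FinitePlace K) {a : k}
    (ha : algebraMap k K a ∉ w.ring) :
    IsDiscreteValuationRing (w.ring.comap (algebraMap k K)) := by
  set v := ((IsDiscreteValuationRing.maximalIdeal w.ring).valuation K).comap (algebraMap k K)
    with hv
  have hle : ∀ x, v x ≤ 1 ↔ algebraMap k K x ∈ w.ring := fun x => w.valuation_le_one_iff _
  have hcomap : w.ring.comap (algebraMap k K) = v.valuationSubring := by
    ext x
    rw [ValuationSubring.mem_comap, Valuation.mem_valuationSubring_iff, hle]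
  have h1 : ¬ v a ≤ 1 := fun h => ha ((hle a).1 h)
  have h0 : v a ≠ 0 := fun h => h1 (by rw [h]; exact zero_le)
  have : Nontrivial (MonoidWithZeroHom.valueGroup (.ofClass v)) := by
    rw [Subgroup.nontrivial_iff_exists_ne_one]
    refine ⟨Units.mk0 (v a) h0, MonoidWithZeroHom.mem_valueGroup _ ⟨a, rfl⟩, fun h => h1 ?_⟩
    have := congrArg Units.val h
    simp only [Units.val_mk0, Units.val_one] at this
    exact this.le
  rw [hcomap]
  infer_instance

theorem algebraMap_mem_sIntegers {S : Set (Place k)} {a : k} (ha : a ∈ sIntegers S) :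
    algebraMap k K a ∈ sIntegers (placesOver K S) := by
  intro w hw
  by_contra h
  have hv := w.isDVR_comap h
  exact h (ha ⟨w.ring.comap (algebraMap k K), hv⟩ fun hS => hw ⟨_, hS, rfl⟩)

variable (K) in
/-- The inclusion `O_{k,S} → O_{K,S_K}`. -/
def sIntegersMap (S : Set (Place k)) : sIntegers S →+* sIntegers (placesOver K S) :=
  ((algebraMap k K).comp (sIntegers S).subtype).codRestrict _
    fun a => algebraMap_mem_sIntegers a.2

theorem sIntegersMap_injective (S : Set (Place k)) : Function.Injective (sIntegersMap K S) := by
  intro a b h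
  exact Subtype.ext ((algebraMap k K).injective (congrArg Subtype.val h))

variable (K) in
/-- The modulus `𝔪_K` of `K` induced by `𝔪`: its finite part is `𝔪_f O_{K,S}`, its infinite part
consists of the real places of `K` over the places that divide `𝔪_∞`. -/
def SModulus.induced {S : Set (Place k)} (m : SModulus S) : SModulus (placesOver K S) where
  fin := m.fin.map (sIntegersMap K S)
  fin_ne_bot := by
    rw [ne_eq, Ideal.map_eq_bot_iff_of_injective (sIntegersMap_injective S)]
    exact m.fin_ne_bot
  inf := {w | w.IsReal ∧ w.comap (algebraMap k K) ∈ m.inf}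
  isReal _ hw := hw.1

variable (K) in
/-- The modulus `𝔪_r` of `k`: the finite part of `𝔪`, together with the real places dividing
`𝔪_∞` that are unramified in `K`, i.e. that stay real in `K`. -/
def SModulus.unramifiedPart {S : Set (Place k)} (m : SModulus S) : SModulus S where
  fin := m.fin
  fin_ne_bot := m.fin_ne_bot
  inf := {v | v ∈ m.inf ∧ v.IsUnramifiedIn K}
  isReal v hv := m.isReal v hv.1

/-! ### The action of the Galois group -/

/-- The isomorphism from `O_w` to `O_{σ w} = σ O_w`. -/
def ringEquivSMul (σ : K ≃ₐ[k] K) (A : ValuationSubring K) :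
    A ≃+* (σ • A : ValuationSubring K) where
  toFun a := ⟨σ a, ValuationSubring.smul_mem_pointwise_smul σ a.1 A a.2⟩
  invFun a := ⟨σ.symm a, (ValuationSubring.mem_pointwise_smul_iff_inv_smul_mem).1 a.2⟩
  left_inv a := Subtype.ext (σ.symm_apply_apply a.1)
  right_inv a := Subtype.ext (σ.apply_symm_apply a.1)
  map_mul' a b := Subtype.ext (map_mul σ a.1 b.1)
  map_add' a b := Subtype.ext (map_add σ a.1 b.1)

/-- The Galois group acts on the finite places; the valuation ring of `σ w` is `σ O_w`. -/
instance FinitePlace.instMulAction : MulAction (K ≃ₐ[k] K) (FinitePlace K) where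
  smul σ w := ⟨σ • w.ring, IsDiscreteValuationRing.RingEquivClass.isDiscreteValuationRing (ringEquivSMul σ w.ring)⟩
  one_smul w := FinitePlace.ext (one_smul _ w.ring)
  mul_smul σ τ w := FinitePlace.ext (mul_smul σ τ w.ring)

theorem ring_smul (σ : K ≃ₐ[k] K) (w : FinitePlace K) : (σ • w).ring = σ • w.ring := rfl

theorem mem_ring_smul {σ : K ≃ₐ[k] K} {w : FinitePlace K} {x : K} :
    σ x ∈ (σ • w).ring ↔ x ∈ w.ring :=
  ValuationSubring.smul_mem_pointwise_smul_iff (g := σ)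

theorem mem_nonunits_smul {σ : K ≃ₐ[k] K} {w : FinitePlace K} {x : K} :
    σ x ∈ (σ • w).ring.nonunits ↔ x ∈ w.ring.nonunits := by
  rw [ValuationSubring.mem_nonunits_iff_or, ValuationSubring.mem_nonunits_iff_or,
    ← map_inv₀, mem_ring_smul, map_eq_zero]

theorem FinitePlace.ordHom_unit {F : Type*} [Field F] (w : FinitePlace F) (x : Fˣ)
    (u : w.ringˣ) (h : (x : F) = (u : w.ring)) : w.ordHom x = 1 := by
  have : x = Units.map (algebraMap w.ring F : w.ring →* F) u := Units.ext h
  rw [FinitePlace.ordHom, MonoidHom.inv_apply, this,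
    IsDedekindDomain.HeightOneSpectrum.valuation_of_unit_eq, inv_one]

theorem FinitePlace.ordHom_irreducible {F : Type*} [Field F] (w : FinitePlace F) (x : Fˣ)
    {p : w.ring} (hp : Irreducible p) (h : (x : F) = p) :
    w.ordHom x = Multiplicative.ofAdd 1 := by
  rw [FinitePlace.ordHom, MonoidHom.inv_apply, inv_eq_iff_eq_inv, ← WithZero.coe_inj,
    IsDedekindDomain.HeightOneSpectrum.valuationOfNeZero_eq, h]
  have := (IsDiscreteValuationRing.maximalIdeal w.ring).valuation_of_algebraMap (K := F) p
  refine this.trans ?_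
  rw [IsDedekindDomain.HeightOneSpectrum.intValuation_singleton _ hp.ne_zero]
  · rfl
  · exact (IsDiscreteValuationRing.irreducible_iff_uniformizer p).1 hp

theorem ordHom_smul_of_mem (σ : K ≃ₐ[k] K) (w : FinitePlace K) (x : Kˣ) (hx : (x : K) ∈ w.ring) :
    (σ • w).ordHom (σ • x) = w.ordHom x := by
  obtain ⟨p, hp⟩ := IsDiscreteValuationRing.exists_irreducible w.ring
  have hx0 : (⟨x, hx⟩ : w.ring) ≠ 0 := fun h => x.ne_zero (congrArg Subtype.val h)
  obtain ⟨n, u, hu⟩ := IsDiscreteValuationRing.eq_unit_mul_pow_irreducible hx0 hp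
  have hp0 : (p : K) ≠ 0 := fun h => hp.ne_zero (Subtype.ext h)
  have hxe : x = Units.map (algebraMap w.ring K : w.ring →* K) u * Units.mk0 (p : K) hp0 ^ n :=
    Units.ext (by simpa using congrArg Subtype.val hu)
  have hp' : Irreducible (ringEquivSMul σ w.ring p) :=
    (MulEquiv.irreducible_iff (ringEquivSMul σ w.ring)).2 hp
  rw [hxe, smul_mul', smul_pow', map_mul, map_mul, map_pow, map_pow,
    w.ordHom_unit _ u rfl, w.ordHom_irreducible _ hp rfl,
    (σ • w).ordHom_unit _ (Units.map (ringEquivSMul σ w.ring : _ →* _) u) rfl,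
    (σ • w).ordHom_irreducible _ hp' rfl]

theorem ord_smul (σ : K ≃ₐ[k] K) (w : FinitePlace K) (x : Kˣ) :
    (σ • w).ord (σ • x) = w.ord x := by
  rw [FinitePlace.ord, FinitePlace.ord]
  congr 1
  rcases w.ring.mem_or_inv_mem (x : K) with h | h
  · exact ordHom_smul_of_mem σ w x h
  · have := ordHom_smul_of_mem σ w x⁻¹ (by simpa using h)
    rwa [smul_inv', map_inv, map_inv, inv_inj] at this

theorem liesOver_smul (σ : K ≃ₐ[k] K) (w : FinitePlace K) (v : Place k) :
    LiesOver (Sum.inl (σ • w)) v ↔ LiesOver (Sum.inl w) v := by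
  have h : (σ • w).ring.comap (algebraMap k K) = w.ring.comap (algebraMap k K) := by
    ext x
    rw [ValuationSubring.mem_comap, ValuationSubring.mem_comap,
      ← mem_ring_smul (σ := σ) (w := w), AlgEquiv.commutes]
  rcases v with v | v
  · simp only [LiesOver, h]
  · rfl

theorem smul_mem_placesOver {S : Set (Place k)} (σ : K ≃ₐ[k] K) (w : FinitePlace K) :
    Sum.inl (σ • w) ∈ placesOver K S ↔ Sum.inl w ∈ placesOver K S := by
  simp only [placesOver, Set.mem_ofPred_eq, liesOver_smul]

theorem map_mem_sIntegers {S : Set (Place k)} (σ : K ≃ₐ[k] K) {x : K}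
    (hx : x ∈ sIntegers (placesOver K S)) : σ x ∈ sIntegers (placesOver K S) := by
  intro w hw
  have h := hx (σ⁻¹ • w) (by rwa [smul_mem_placesOver])
  rw [← mem_ring_smul (σ := σ), smul_inv_smul] at h
  exact h

namespace SModulus

variable {S : Set (Place k)} (m : SModulus S)

theorem map_mem_fin (σ : K ≃ₐ[k] K) (a : sIntegers (placesOver K S))
    (ha : a ∈ (m.induced K).fin) :
    (⟨σ a, map_mem_sIntegers σ a.2⟩ : sIntegers (placesOver K S)) ∈ (m.induced K).fin := by
  change a ∈ Ideal.span _ at ha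
  induction ha using Submodule.span_induction with
  | mem a ha =>
    obtain ⟨b, hb, rfl⟩ := ha
    have : (⟨σ (sIntegersMap K S b), map_mem_sIntegers σ (sIntegersMap K S b).2⟩ :
        sIntegers (placesOver K S)) = sIntegersMap K S b :=
      Subtype.ext (σ.commutes b.1)
    rw [this]
    exact Ideal.mem_map_of_mem _ hb
  | zero =>
    convert (m.induced K).fin.zero_mem
    simp
  | add a b _ _ ha hb =>
    convert add_mem ha hb
    simp
  | smul c a _ ha =>
    convert (m.induced K).fin.mul_mem_left ⟨σ c, map_mem_sIntegers σ c.2⟩ ha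
    simp

theorem finDvd_smul_of {σ : K ≃ₐ[k] K} {w : FinitePlace K} (h : (m.induced K).FinDvd w) :
    (m.induced K).FinDvd (σ • w) := by
  refine ⟨by rw [smul_mem_placesOver]; exact h.1, fun a ha => ?_⟩
  have := h.2 _ (m.map_mem_fin σ⁻¹ a ha)
  rw [← mem_nonunits_smul (σ := σ)] at this
  convert this
  exact (σ.apply_symm_apply _).symm

theorem finDvd_smul {σ : K ≃ₐ[k] K} {w : FinitePlace K} :
    (m.induced K).FinDvd (σ • w) ↔ (m.induced K).FinDvd w := by
  refine ⟨fun h => ?_, m.finDvd_smul_of⟩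
  have := m.finDvd_smul_of (σ := σ⁻¹) h
  rwa [inv_smul_smul] at this

theorem map_mem_localIdeal (σ : K ≃ₐ[k] K) (w : FinitePlace K) {x : K}
    (hx : x ∈ (m.induced K).localIdeal w) : σ x ∈ (m.induced K).localIdeal (σ • w) := by
  induction hx using Submodule.span_induction with
  | mem x hx =>
    obtain ⟨a, ha, rfl⟩ := hx
    exact Submodule.subset_span ⟨_, m.map_mem_fin σ a ha, rfl⟩
  | zero => rw [map_zero]; exact zero_mem _
  | add x y _ _ hx hy => rw [map_add]; exact add_mem hx hy
  | smul a x _ hx =>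
    rw [show a • x = (a : K) * x from rfl, map_mul]
    exact Submodule.smul_mem _ (⟨σ a, mem_ring_smul.2 a.2⟩ : (σ • w).ring) hx

theorem smul_mem_rayGroup (σ : K ≃ₐ[k] K) {x : Kˣ} (hx : x ∈ (m.induced K).rayGroup) :
    σ • x ∈ (m.induced K).rayGroup := by
  refine ⟨fun w hw => ?_, fun w hw => ?_⟩
  · have h := m.map_mem_localIdeal σ _ (hx.1 (σ⁻¹ • w) (m.finDvd_smul.2 hw))
    rwa [smul_inv_smul, map_sub, map_one] at h
  · have hr : (w.comap (σ : K →+* K)).IsReal := hw.1.comap _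
    have hmem : w.comap (σ : K →+* K) ∈ (m.induced K).inf := by
      refine ⟨hr, ?_⟩
      rw [← NumberField.InfinitePlace.comap_comp]
      convert hw.2
      ext x
      exact σ.commutes x
    have h := hx.2 _ hmem
    convert h using 1
    apply Complex.ofReal_injective
    rw [NumberField.InfinitePlace.embedding_of_isReal_apply,
      NumberField.InfinitePlace.embedding_of_isReal_apply,
      NumberField.InfinitePlace.comap_embedding_of_isReal _ hr]
    rfl

theorem smul_mem_unitGroup (σ : K ≃ₐ[k] K) {x : Kˣ} (hx : x ∈ (m.induced K).unitGroup) :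
    σ • x ∈ (m.induced K).unitGroup := by
  refine ⟨⟨map_mem_sIntegers σ hx.1.1, ?_⟩, m.smul_mem_rayGroup σ hx.2⟩
  rw [← smul_inv']
  exact map_mem_sIntegers σ hx.1.2

/-- `K^𝔪` as a `Gal(K/k)`-module. -/
instance rayGroupAction : MulDistribMulAction (K ≃ₐ[k] K) (m.induced K).rayGroup where
  smul σ x := ⟨σ • x.1, m.smul_mem_rayGroup σ x.2⟩
  one_smul x := Subtype.ext (one_smul _ x.1)
  mul_smul σ τ x := Subtype.ext (mul_smul σ τ x.1)
  smul_mul σ x y := Subtype.ext (smul_mul' σ x.1 y.1)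
  smul_one σ := Subtype.ext (smul_one σ)

/-- `E^𝔪_{K,S}` as a `Gal(K/k)`-module. -/
instance unitGroupAction : MulDistribMulAction (K ≃ₐ[k] K) (m.induced K).unitGroup where
  smul σ x := ⟨σ • x.1, m.smul_mem_unitGroup σ x.2⟩
  one_smul x := Subtype.ext (one_smul _ x.1)
  mul_smul σ τ x := Subtype.ext (mul_smul σ τ x.1)
  smul_mul σ x y := Subtype.ext (smul_mul' σ x.1 y.1)
  smul_one σ := Subtype.ext (smul_one σ)

theorem smul_mem_divisorGroup (σ : K ≃ₐ[k] K) {D : FinitePlace K →₀ ℤ}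
    (hD : D ∈ (m.induced K).divisorGroup) :
    D.mapDomain (σ • ·) ∈ (m.induced K).divisorGroup := by
  intro w hw
  have h : D.mapDomain (σ • ·) (σ • (σ⁻¹ • w)) = D (σ⁻¹ • w) :=
    Finsupp.mapDomain_apply (MulAction.injective σ) D (σ⁻¹ • w)
  rw [smul_inv_smul] at h
  rw [h]
  refine hD _ ?_
  rcases hw with hw | hw
  · exact Or.inl ((smul_mem_placesOver _ _).2 hw)
  · exact Or.inr (m.finDvd_smul.2 hw)

/-- `I_K^{S(𝔪) ∪ S}` as a `Gal(K/k)`-module: `σ` maps `∑ n_w w` to `∑ n_w σ(w)`. -/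
instance divisorGroupAction : DistribMulAction (K ≃ₐ[k] K) (m.induced K).divisorGroup where
  smul σ D := ⟨D.1.mapDomain (σ • ·), m.smul_mem_divisorGroup σ D.2⟩
  one_smul D := Subtype.ext (by
    change D.1.mapDomain (fun w => (1 : K ≃ₐ[k] K) • w) = D.1
    simp only [one_smul]
    exact Finsupp.mapDomain_id)
  mul_smul σ τ D := Subtype.ext (by
    change D.1.mapDomain (fun w => (σ * τ) • w) = (D.1.mapDomain (τ • ·)).mapDomain (σ • ·)
    rw [← Finsupp.mapDomain_comp]
    simp only [mul_smul]
    rfl)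
  smul_zero σ := Subtype.ext (Finsupp.mapDomain_zero (f := (σ • · : FinitePlace K → FinitePlace K)))
  smul_add σ D E := Subtype.ext Finsupp.mapDomain_add

theorem smul_mem_principalDivisors (σ : K ≃ₐ[k] K) {D : (m.induced K).divisorGroup}
    (hD : D ∈ (m.induced K).principalDivisors) :
    σ • D ∈ (m.induced K).principalDivisors := by
  obtain ⟨x, hx, h⟩ := hD
  refine ⟨σ • x, m.smul_mem_rayGroup σ hx, fun w hw => ?_⟩
  have h1 : (σ • D).1 (σ • (σ⁻¹ • w)) = D.1 (σ⁻¹ • w) :=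
    Finsupp.mapDomain_apply (MulAction.injective σ) D.1 (σ⁻¹ • w)
  have h2 := ord_smul σ (σ⁻¹ • w) x
  rw [smul_inv_smul] at h1 h2
  rw [h1, h2]
  exact h _ (by rwa [smul_mem_placesOver])

/-- `Cl^𝔪_{K,S}` as a `Gal(K/k)`-module. -/
instance classGroupAction : DistribMulAction (K ≃ₐ[k] K) (m.induced K).ClassGroup where
  smul σ := QuotientAddGroup.map (m.induced K).principalDivisors (m.induced K).principalDivisors
    (DistribSMul.toAddMonoidHom _ σ)
    fun _ hD => m.smul_mem_principalDivisors σ hD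
  one_smul c := by
    induction c using QuotientAddGroup.induction_on with
    | H D => exact congrArg QuotientAddGroup.mk (one_smul (K ≃ₐ[k] K) D)
  mul_smul σ τ c := by
    induction c using QuotientAddGroup.induction_on with
    | H D => exact congrArg QuotientAddGroup.mk (mul_smul σ τ D)
  smul_zero σ := map_zero (QuotientAddGroup.map _ _ _ _)
  smul_add σ := map_add (QuotientAddGroup.map _ _ _ _)

end SModulus

end Extension

/-! ### Cohomology -/

section Cohomology

variable {k : Type*} {K : Type} [Field k] [Field K] [Algebra k K]
  {S : Set (Place k)} (m : SModulus S)

variable (K) in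
/-- The `Gal(K/k)`-module `E^𝔪_{K,S}`. -/
abbrev SModulus.unitRep : Rep ℤ (K ≃ₐ[k] K) :=
  Rep.ofMulDistribMulAction (K ≃ₐ[k] K) (m.induced K).unitGroup

variable (K) in
/-- The `Gal(K/k)`-module `K^𝔪`. -/
abbrev SModulus.rayRep : Rep ℤ (K ≃ₐ[k] K) :=
  Rep.ofMulDistribMulAction (K ≃ₐ[k] K) (m.induced K).rayGroup

variable (K) in
/-- The inclusion `E^𝔪_{K,S} → K^𝔪` of `Gal(K/k)`-modules. -/
def SModulus.unitInclusion : m.unitRep K ⟶ m.rayRep K :=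
  Rep.ofHom
    { toLinearMap := (MonoidHom.toAdditive (Subgroup.inclusion inf_le_right :
          (m.induced K).unitGroup →* (m.induced K).rayGroup)).toIntLinearMap
      isIntertwining' := fun _ => rfl }

variable (K) in
/-- The map `H²(Gal(K/k), E^𝔪_{K,S}) → H²(Gal(K/k), K^𝔪)` induced by the inclusion. -/
def SModulus.H2Map :
    groupCohomology.H2 (m.unitRep K) ⟶ groupCohomology.H2 (m.rayRep K) :=
  groupCohomology.map (MonoidHom.id (K ≃ₐ[k] K)) (m.unitInclusion K) 2

end Cohomology

end RayClass

/-!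
The sequences `0 → E → K^𝔪 → P → 0` and `0 → P → I → Cl → 0`, with `I = I_K^{S ∪ S(𝔪)}` and `P` its
subgroup of principal divisors, give long exact sequences in `G`-cohomology. As `I` is a permutation
module, `H¹(G, I) = 0`, so counting along both sequences expresses `|Cl^G|` through the index of
the image of `(K^𝔪)^G` in `I^G` and the orders of `H¹(G, E)`, `H²(G, E)`, `H¹(G, K^𝔪)` and of the
image of `H²(G, E) → H²(G, K^𝔪)`.

By Galois descent `(K^𝔪)^G = k^{𝔪_r}`: a positive element of `k` is needed only at the real places
of `𝔪` that stay real in `K`. Extension of divisors sends a place `v` to `e_v ∑_{w ∣ v} w`, while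
`I^G` is free on the sums `∑_{w ∣ v} w`. Hence the index is `|Cl^{𝔪_r}_k| ∏ e_v`; that it is finite
also shows that `e_v = 1` for almost all `v`.

Finiteness of `Cl`, and of the cohomology of `E` and of `K^𝔪`, rests on the finiteness of the class
group and the finite generation of the unit group of a ring of `S`-integers, and on Hilbert 90.
-/

namespace RayClass

open IsDedekindDomain WithZero nonZeroDivisors NumberField

/-! ### Integral closures -/

section IntegralClosure

theorem finite_of_injective_of_comp_algebraMap_eq {A B C : Type*} [CommRing A]
    [IsNoetherianRing A] [CommRing B] [CommRing C] [Algebra A B] [Algebra A C] [Module.Finite A C]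
    {f : A →+* A} (hf : f.Finite) {φ : B →+* C} (hφ : Function.Injective φ)
    (h : φ.comp (algebraMap A B) = (algebraMap A C).comp f) : Module.Finite A B := by
  have hfin : (φ.comp (algebraMap A B)).Finite :=
    h ▸ (RingHom.finite_algebraMap.2 inferInstance).comp hf
  let : Module A C := (φ.comp (algebraMap A B)).toModule
  have : Module.Finite A C := hfin
  let ψ : B →ₗ[A] C :=
    { φ with
      map_smul' := fun a b => by
        change φ (a • b) = φ (algebraMap A B a) * φ b
        rw [Algebra.smul_def, map_mul] }
  exact .of_injective ψ hφ

theorem finite_iterateFrobenius {A : Type*} [CommRing A] (p : ℕ) [ExpChar A p]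
    (hA : (frobenius A p).Finite) (n : ℕ) : (iterateFrobenius A p n).Finite := by
  induction n with
  | zero => exact iterateFrobenius_zero A p ▸ .id A
  | succ n ih =>
    rw [iterateFrobenius_add, iterateFrobenius_one]
    exact ih.comp hA

variable (A Q F : Type*) [CommRing A] [Field Q] [Algebra A Q] [IsFractionRing A Q]
  [Field F] [Algebra A F] [Algebra Q F] [IsScalarTower A Q F] [FiniteDimensional Q F]

/- A power of Frobenius embeds the integral closure in `F` into the integral closure in the
separable closure of `Q` in `F`, where finiteness is known. -/
include Q in
theorem finite_integralClosure_of_finite_frobenius [IsDomain A] [IsNoetherianRing A]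
    [IsIntegrallyClosed A] (p : ℕ) [ExpChar A p] (hA : (frobenius A p).Finite) :
    Module.Finite A (integralClosure A F) := by
  have : ExpChar Q p := expChar_of_injective_algebraMap (IsFractionRing.injective A Q) p
  have : ExpChar F p := expChar_of_injective_algebraMap (algebraMap Q F).injective p
  let L := separableClosure Q F
  have : ExpChar L p := expChar_of_injective_algebraMap (algebraMap Q L).injective p
  have : IsScalarTower A L F := .of_algebraMap_eq fun _ => rfl
  have : Module.Finite A (integralClosure A L) := IsIntegralClosure.finite A Q L _
  let n := IsPurelyInseparable.exponent L F
  let φ₀ : integralClosure A F →+* L :=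
    (IsPurelyInseparable.iterateFrobenius L F p le_rfl).comp (integralClosure A F).subtype
  have hφ₀ (x : integralClosure A F) : (φ₀ x : F) = (x : F) ^ p ^ n :=
    IsPurelyInseparable.algebraMap_iterateFrobenius L p le_rfl (x : F)
  have h_integral (x : integralClosure A F) : IsIntegral A (φ₀ x) := by
    rw [← isIntegral_algebraMap_iff (algebraMap L F).injective]
    change IsIntegral A (φ₀ x : F)
    exact hφ₀ x ▸ x.2.pow _
  let φ : integralClosure A F →+* integralClosure A L :=
    φ₀.codRestrict (integralClosure A L).toSubring h_integral
  have hφ : Function.Injective φ :=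
    fun _ _ h => Subtype.ext ((IsPurelyInseparable.iterateFrobenius L F p le_rfl).injective
      (congrArg Subtype.val h))
  refine finite_of_injective_of_comp_algebraMap_eq (finite_iterateFrobenius p hA n) hφ
    (RingHom.ext fun a => ?_)
  refine Subtype.ext (Subtype.ext ((hφ₀ _).trans ?_))
  change algebraMap A F a ^ p ^ n = algebraMap A F (iterateFrobenius A p n a)
  rw [iterateFrobenius_def, map_pow]

include Q in
theorem isDedekindDomain_integralClosure_of_finite [IsDedekindDomain A]
    [Module.Finite A (integralClosure A F)] : IsDedekindDomain (integralClosure A F) :=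
  have := integralClosure.isIntegrallyClosedOfFiniteExtension (R := A) Q (L := F)
  have : IsNoetherianRing (integralClosure A F) := IsNoetherianRing.of_finite A _
  { }

end IntegralClosure

section Polynomial

open Polynomial

theorem finite_frobenius_polynomial (k : Type*) [Field k] (p : ℕ) [ExpChar k p]
    [PerfectRing k p] : (frobenius k[X] p).Finite := by
  refine RingHom.IsIntegral.to_finite (fun a => ?_) ?_
  · exact ⟨X ^ p - C a, monic_X_pow_sub_C _ (expChar_pos k p).ne', by simp [frobenius_def]⟩
  · have hC : (frobenius k[X] p).comp C = C.comp (frobenius k p) :=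
      RingHom.ext fun a => by simp [frobenius_def]
    refine RingHom.FiniteType.of_comp_finiteType (f := (C : k →+* k[X])) ?_
    rw [hC]
    exact (RingHom.finiteType_algebraMap.2 (inferInstance : Algebra.FiniteType k k[X])).comp
      (.of_surjective _ (bijective_frobenius k p).surjective)

instance hasFiniteQuotients_polynomial (k : Type*) [Field k] [Finite k] :
    Ring.HasFiniteQuotients k[X] where
  finiteQuotient {I} hI := by
    obtain ⟨f, rfl⟩ := Submodule.IsPrincipal.principal I
    have : Module.Finite k (AdjoinRoot f) :=
      (AdjoinRoot.powerBasis (by simpa using hI)).finite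
    exact Module.finite_of_finite k (M := AdjoinRoot f)

variable (k Q F : Type*) [Field k] [Finite k] [Field Q] [Algebra k[X] Q] [IsFractionRing k[X] Q]
  [Field F] [Algebra k[X] F] [Algebra Q F] [IsScalarTower k[X] Q F] [FiniteDimensional Q F]

include Q in
theorem finite_integralClosure_polynomial : Module.Finite k[X] (integralClosure k[X] F) :=
  let p := ringExpChar k
  finite_integralClosure_of_finite_frobenius k[X] Q F p (finite_frobenius_polynomial k p)

include Q in
theorem finite_classGroup_integralClosure_polynomial :
    Finite (ClassGroup (integralClosure k[X] F)) := by
  classical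
  have := Fintype.ofFinite k
  have := finite_integralClosure_polynomial k Q F
  have := isDedekindDomain_integralClosure_of_finite k[X] Q F
  have : FaithfulSMul k[X] F := by
    rw [faithfulSMul_iff_algebraMap_injective, IsScalarTower.algebraMap_eq k[X] Q F]
    exact (algebraMap Q F).injective.comp (IsFractionRing.injective _ _)
  have := ClassGroup.fintypeOfAdmissibleOfAlgebraic
    (Module.Free.chooseBasis k[X] (integralClosure k[X] F))
    (Polynomial.cardPowDegreeIsAdmissible : (Polynomial.cardPowDegree (Fq := k)).IsAdmissible)
  infer_instance

end Polynomial

/-! ### Finite places and primes of Dedekind domains -/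

section FinitePlace

variable {F : Type*} [Field F]

theorem mem_valuationSubring_of_isIntegral {A : Type*} [CommRing A] [Algebra A F]
    (V : ValuationSubring F) (hA : ∀ a, algebraMap A F a ∈ V) {x : F} (hx : IsIntegral A x) :
    x ∈ V := by
  let φ : A →+* V := (algebraMap A F).codRestrict V.toSubring hA
  have hxV : IsIntegral V x := by
    obtain ⟨f, hf, hfx⟩ := hx
    exact ⟨f.map φ, hf.map φ, by rw [Polynomial.eval₂_map]; exact hfx⟩
  obtain ⟨y, rfl⟩ := IsIntegrallyClosed.isIntegral_iff.1 hxV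
  exact y.2

theorem valuation_le_exp_neg_one {v : Valuation F ℤᵐ⁰} {x : F} (hx : v x < 1) :
    v x ≤ exp (-1) := by
  rcases eq_or_ne (v x) 0 with h | h
  · exact h ▸ zero_le
  · rw [← exp_log h, ← exp_zero, exp_lt_exp] at hx
    rw [← exp_log h, exp_le_exp]
    omega

theorem valuation_eq_of_isEquiv {u v : Valuation F ℤᵐ⁰} (h : u.IsEquiv v)
    (hu : ∃ y, u y = exp (-1)) (hv : ∃ y, v y = exp (-1)) : u = v := by
  obtain ⟨π, hπ⟩ := hu
  obtain ⟨π', hπ'⟩ := hv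
  have hexp : (exp (-1) : ℤᵐ⁰) < 1 := by rw [← exp_zero, exp_lt_exp]; omega
  have hvπ : v π = exp (-1) := by
    refine (valuation_le_exp_neg_one (h.lt_one_iff_lt_one.1 (hπ ▸ hexp))).antisymm ?_
    rw [← hπ', ← h.le_iff_le, hπ]
    exact valuation_le_exp_neg_one (h.lt_one_iff_lt_one.2 (hπ' ▸ hexp))
  ext x
  rcases eq_or_ne x 0 with rfl | hx
  · rw [map_zero, map_zero]
  · have hvx : v x = v (π ^ (-log (v x))) := by
      rw [map_zpow₀, hvπ, ← exp_zsmul, smul_eq_mul, neg_mul_neg, mul_one,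
        exp_log ((Valuation.ne_zero_iff v).2 hx)]
    rw [hvx, h.eq_iff.2 hvx, map_zpow₀, map_zpow₀, hπ, hvπ]

namespace FinitePlace

variable (w : FinitePlace F)

theorem ord_mul (x y : Fˣ) : w.ord (x * y) = w.ord x + w.ord y := by simp [ord]

theorem ord_one : w.ord 1 = 0 := by simp [ord]

theorem ord_inv (x : Fˣ) : w.ord x⁻¹ = -w.ord x := by simp [ord]

theorem ord_pow (x : Fˣ) (n : ℕ) : w.ord (x ^ n) = n * w.ord x := by simp [ord]

theorem ord_zpow (x : Fˣ) (n : ℤ) : w.ord (x ^ n) = n * w.ord x := by simp [ord]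

theorem valuation_eq_exp_neg_ord (x : Fˣ) :
    (IsDiscreteValuationRing.maximalIdeal w.ring).valuation F x = exp (-w.ord x) := by
  rw [← HeightOneSpectrum.valuationOfNeZero_eq, ord, ordHom, MonoidHom.inv_apply, toAdd_inv,
    neg_neg]
  rfl

theorem mem_ring_iff (x : Fˣ) : (x : F) ∈ w.ring ↔ 0 ≤ w.ord x := by
  rw [← valuation_le_one_iff, valuation_eq_exp_neg_ord, ← exp_zero, exp_le_exp, neg_nonpos]

theorem mem_nonunits_iff (x : Fˣ) : (x : F) ∈ w.ring.nonunits ↔ 0 < w.ord x := by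
  rw [ValuationSubring.mem_nonunits_iff_or, or_iff_right x.ne_zero, ← Units.val_inv_eq_inv_val,
    mem_ring_iff, ord_inv]
  omega

theorem div_mem_ring_of_ord_le {a b : Fˣ} (h : w.ord a ≤ w.ord b) : (b : F) / a ∈ w.ring := by
  rw [div_eq_mul_inv, ← Units.val_inv_eq_inv_val, ← Units.val_mul, w.mem_ring_iff, w.ord_mul,
    w.ord_inv]
  omega

theorem exists_ord_eq_one : ∃ x : Fˣ, w.ord x = 1 := by
  obtain ⟨π, hπ⟩ := IsDiscreteValuationRing.exists_irreducible w.ring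
  refine ⟨Units.mk0 π (fun h => hπ.ne_zero (Subtype.ext h)), ?_⟩
  rw [ord, w.ordHom_irreducible _ hπ rfl]
  rfl

theorem ring_ne_top : w.ring ≠ ⊤ := by
  intro h
  obtain ⟨x, hx⟩ := w.exists_ord_eq_one
  have hinv : ((x⁻¹ : Fˣ) : F) ∈ w.ring := h ▸ ValuationSubring.mem_top _
  rw [mem_ring_iff, ord_inv] at hinv
  omega

end FinitePlace

end FinitePlace

section PlaceOfPrime

variable (F : Type*) [Field F] {R : Type*} [CommRing R] [IsDedekindDomain R] [Algebra R F]
  [IsFractionRing R F]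

/-- The finite place of `F` defined by a nonzero prime of a Dedekind domain with field of
fractions `F`. -/
def placeOfPrime (v : HeightOneSpectrum R) : FinitePlace F where
  ring := (v.valuation F).valuationSubring
  isDVR := by
    have : Nontrivial (MonoidWithZeroHom.valueGroup (.ofClass (v.valuation F))) := by
      obtain ⟨π, hπ⟩ := v.valuation_exists_uniformizer F
      have hπ0 : v.valuation F π ≠ 0 := by rw [hπ]; exact exp_ne_zero
      rw [Subgroup.nontrivial_iff_exists_ne_one]
      refine ⟨Units.mk0 (v.valuation F π) hπ0, MonoidWithZeroHom.mem_valueGroup _ ⟨π, rfl⟩,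
        fun h => ?_⟩
      have := congrArg Units.val h
      rw [Units.val_mk0, hπ, Units.val_one, ← exp_zero, exp_inj] at this
      omega
    infer_instance

variable {F}

theorem mem_placeOfPrime_ring (v : HeightOneSpectrum R) (x : F) :
    x ∈ (placeOfPrime F v).ring ↔ v.valuation F x ≤ 1 := Iff.rfl

theorem valuation_eq_exp_neg_ord_placeOfPrime (v : HeightOneSpectrum R) (x : Fˣ) :
    v.valuation F x = exp (-(placeOfPrime F v).ord x) := by
  set w := placeOfPrime F v
  have hequiv : (v.valuation F).IsEquiv
      ((IsDiscreteValuationRing.maximalIdeal w.ring).valuation F) :=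
    Valuation.isEquiv_iff_val_le_one.2 fun {x} => (w.valuation_le_one_iff x).symm
  rw [valuation_eq_of_isEquiv hequiv (v.valuation_exists_uniformizer F)
    (HeightOneSpectrum.valuation_exists_uniformizer F _), w.valuation_eq_exp_neg_ord]

theorem algebraMap_mem_placeOfPrime_ring (v : HeightOneSpectrum R) (r : R) :
    algebraMap R F r ∈ (placeOfPrime F v).ring := v.valuation_le_one r

theorem inv_mem_of_notMem_nonunits {V : ValuationSubring F} {x : F} (hx : x ∉ V.nonunits) :
    x⁻¹ ∈ V := by
  rw [ValuationSubring.mem_nonunits_iff_or] at hx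
  push Not at hx
  exact hx.2

theorem exists_placeOfPrime_ring_eq (V : ValuationSubring F) (hV : V ≠ ⊤)
    (hR : ∀ r : R, algebraMap R F r ∈ V) :
    ∃ v : HeightOneSpectrum R, (placeOfPrime F v).ring = V := by
  let f : R →+* V := (algebraMap R F).codRestrict V.toSubring hR
  have hf (r : R) :
      r ∈ (IsLocalRing.maximalIdeal V).comap f ↔ algebraMap R F r ∈ V.nonunits := by
    rw [Ideal.mem_comap, ← ValuationSubring.coe_mem_nonunits_iff]
    rfl
  let v : HeightOneSpectrum R :=
    { asIdeal := (IsLocalRing.maximalIdeal V).comap f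
      isPrime := inferInstance
      ne_bot := by
        intro h
        refine hV (top_le_iff.1 fun x _ => ?_)
        obtain ⟨a, b, hb, rfl⟩ := IsFractionRing.div_surjective (A := R) x
        rw [div_eq_mul_inv]
        refine mul_mem (hR a) (inv_mem_of_notMem_nonunits fun hbV => nonZeroDivisors.ne_zero hb ?_)
        rwa [← hf, h] at hbV }
  have hle : (placeOfPrime F v).ring ≤ V := by
    intro x hx
    obtain ⟨n, d, h⟩ := v.exists_primeCompl_mul_eq_of_integer x hx
    have hd : algebraMap R F d ∉ V.nonunits := fun hdV => d.2 ((hf _).2 hdV)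
    have hd0 : algebraMap R F d ≠ 0 :=
      fun h0 => hd ((ValuationSubring.mem_nonunits_iff_or _).2 (Or.inl h0))
    rw [eq_div_of_mul_eq hd0 h, div_eq_mul_inv]
    exact mul_mem (hR n) (inv_mem_of_notMem_nonunits hd)
  exact ⟨v, ValuationSubring.eq_of_le_of_ne_top _ hle hV⟩

theorem exists_placeOfPrime_eq (w : FinitePlace F) (hR : ∀ r : R, algebraMap R F r ∈ w.ring) :
    ∃ v : HeightOneSpectrum R, placeOfPrime F v = w :=
  (exists_placeOfPrime_ring_eq w.ring w.ring_ne_top hR).imp fun _ => FinitePlace.ext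

theorem placeOfPrime_injective :
    Function.Injective (placeOfPrime F : HeightOneSpectrum R → FinitePlace F) := by
  intro v v' h
  refine HeightOneSpectrum.eq_of_valuation_isEquiv_valuation (K := F) ?_
  rw [Valuation.isEquiv_iff_val_le_one]
  intro x
  rw [← mem_placeOfPrime_ring, ← mem_placeOfPrime_ring, h]

variable (R) in
theorem finite_setOf_algebraMap_mem_and_ord_ne_zero (x : Fˣ) :
    {w : FinitePlace F | (∀ r : R, algebraMap R F r ∈ w.ring) ∧ w.ord x ≠ 0}.Finite := by
  refine (((HeightOneSpectrum.Support.finite R (x : F)).union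
    (HeightOneSpectrum.Support.finite R ((x⁻¹ : Fˣ) : F))).image (placeOfPrime F)).subset ?_
  rintro w ⟨hR, hw⟩
  obtain ⟨v, rfl⟩ := exists_placeOfPrime_eq w hR
  refine ⟨v, ?_, rfl⟩
  change 1 < v.valuation F (x : F) ∨ 1 < v.valuation F ((x⁻¹ : Fˣ) : F)
  rw [valuation_eq_exp_neg_ord_placeOfPrime, valuation_eq_exp_neg_ord_placeOfPrime, ← exp_zero,
    exp_lt_exp, exp_lt_exp, FinitePlace.ord_inv]
  omega

variable (R) in
theorem exists_algebraMap_eq_of_forall_mem_ring {x : F}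
    (hx : ∀ w : FinitePlace F, (∀ r : R, algebraMap R F r ∈ w.ring) → x ∈ w.ring) :
    ∃ r : R, algebraMap R F r = x :=
  HeightOneSpectrum.mem_integers_of_valuation_le_one F x fun v =>
    hx _ (algebraMap_mem_placeOfPrime_ring v)

end PlaceOfPrime

/-! ### Arithmetic subrings of function fields -/

section ArithmeticSubring

variable {F : Type*} [Field F]

/-- A subring `R` of `F` is arithmetic if it shares the finiteness properties of a ring of
`S`-integers in its field of fractions `F`. -/
class IsArithmeticSubring (R : Subring F) : Prop where
  isDedekindDomain : IsDedekindDomain R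
  isFractionRing : IsFractionRing R F
  hasFiniteQuotients : Ring.HasFiniteQuotients R
  finite_classGroup : Finite (ClassGroup R)

attribute [instance] IsArithmeticSubring.isDedekindDomain IsArithmeticSubring.isFractionRing
  IsArithmeticSubring.hasFiniteQuotients IsArithmeticSubring.finite_classGroup

variable {R : Type*} [CommRing R] [IsDedekindDomain R] [Algebra R F] [IsFractionRing R F]

theorem hasFiniteQuotients_ring [Ring.HasFiniteQuotients R] (w : FinitePlace F)
    (hR : ∀ r : R, algebraMap R F r ∈ w.ring) : Ring.HasFiniteQuotients w.ring where
  finiteQuotient {I} hI := by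
    let φ : R →+* w.ring := (algebraMap R F).codRestrict w.ring.toSubring hR
    obtain ⟨a, ha, ha0⟩ := Submodule.exists_mem_ne_zero_of_ne_bot hI
    have ha0F : (a : F) ≠ 0 := fun h => ha0 (Subtype.ext h)
    have hcomap : I.comap φ ≠ ⊥ := by
      obtain ⟨r, s, hs, hrs⟩ := IsFractionRing.div_surjective (A := R) (a : F)
      have hs0 : algebraMap R F s ≠ 0 := IsFractionRing.to_map_ne_zero_of_mem_nonZeroDivisors hs
      have hra : φ r = φ s * a := Subtype.ext (by
        change algebraMap R F r = algebraMap R F s * a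
        rw [← hrs, mul_div_cancel₀ _ hs0])
      refine (Submodule.ne_bot_iff _).2 ⟨r, Ideal.mem_comap.2 (hra ▸ I.mul_mem_left _ ha), ?_⟩
      rintro rfl
      rw [map_zero, zero_div] at hrs
      exact ha0F hrs.symm
    have : Finite (R ⧸ I.comap φ) := Ring.HasFiniteQuotients.finiteQuotient hcomap
    refine Finite.of_surjective (Ideal.quotientMap I φ le_rfl) fun q => ?_
    obtain ⟨x, rfl⟩ := Ideal.Quotient.mk_surjective q
    obtain ⟨v, rfl⟩ := exists_placeOfPrime_eq w hR
    have hva : v.valuation F (a : F) ≠ 0 := (Valuation.ne_zero_iff _).2 ha0F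
    obtain ⟨b, hb⟩ := v.exists_valuation_sub_lt_of_integer x.2 (Units.mk0 _ hva)
    have hdiv : (algebraMap R F b - x) / a ∈ (placeOfPrime F v).ring := by
      rw [mem_placeOfPrime_ring, map_div₀]
      exact (div_le_one₀ (zero_lt_iff.2 hva)).2 hb.le
    refine ⟨Ideal.Quotient.mk _ b, ?_⟩
    rw [Ideal.quotientMap_mk, Ideal.Quotient.eq]
    have hmul : φ b - x = ⟨_, hdiv⟩ * a := Subtype.ext (div_mul_cancel₀ _ ha0F).symm
    exact hmul ▸ I.mul_mem_left _ ha

theorem exists_forall_mem_asIdeal_iff_eq [Finite (ClassGroup R)] (v₀ : HeightOneSpectrum R) :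
    ∃ π : R, π ≠ 0 ∧ ∀ v : HeightOneSpectrum R, π ∈ v.asIdeal ↔ v = v₀ := by
  have hv₀ : v₀.asIdeal ∈ nonZeroDivisors (Ideal R) := mem_nonZeroDivisors_of_ne_zero v₀.ne_bot
  have hprincipal : (v₀.asIdeal ^ Nat.card (ClassGroup R)).IsPrincipal := by
    rw [← ClassGroup.mk0_eq_one_iff (pow_mem hv₀ _)]
    have h := pow_card_eq_one' (x := ClassGroup.mk0 ⟨v₀.asIdeal, hv₀⟩)
    rwa [← map_pow] at h
  obtain ⟨π, hπ⟩ := hprincipal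
  rw [Ideal.submodule_span_eq] at hπ
  refine ⟨π, ?_, fun v => ?_⟩
  · rintro rfl
    rw [Ideal.span_singleton_zero] at hπ
    exact pow_ne_zero _ v₀.ne_bot hπ
  rw [← Ideal.span_singleton_le_iff_mem, ← hπ]
  constructor
  · intro h
    exact HeightOneSpectrum.ext
      (v₀.isMaximal.eq_of_le v.isPrime.ne_top (Ideal.IsPrime.le_of_pow_le h)).symm
  · rintro rfl
    exact Ideal.pow_le_self Nat.card_pos.ne'

theorem exists_mem_ring_iff_ne_of_finite_classGroup [Finite (ClassGroup R)] (w₀ : FinitePlace F)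
    (hw₀ : ∀ r : R, algebraMap R F r ∈ w₀.ring) :
    ∃ y : F, ∀ w : FinitePlace F, (∀ r : R, algebraMap R F r ∈ w.ring) →
      (y ∈ w.ring ↔ w ≠ w₀) := by
  obtain ⟨v₀, rfl⟩ := exists_placeOfPrime_eq w₀ hw₀
  obtain ⟨π, hπ₀, hπ⟩ := exists_forall_mem_asIdeal_iff_eq v₀
  refine ⟨(algebraMap R F π)⁻¹, fun w hw => ?_⟩
  obtain ⟨v, rfl⟩ := exists_placeOfPrime_eq w hw
  rw [mem_placeOfPrime_ring, map_inv₀, placeOfPrime_injective.ne_iff, ← not_iff_not, not_not,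
    ← hπ v, ← v.valuation_lt_one_iff_mem (K := F), not_le]
  exact one_lt_inv₀ (zero_lt_iff.2 ((Valuation.ne_zero_iff _).2
    ((map_ne_zero_iff _ (IsFractionRing.injective R F)).2 hπ₀)))

end ArithmeticSubring

section FunctionField

open Polynomial

theorem isAlgebraic_of_trdeg_eq {k A B : Type*} [CommRing k] [Nontrivial k] [CommRing A]
    [CommRing B] [IsDomain B] [Algebra k A] [Algebra A B] [Algebra k B] [IsScalarTower k A B]
    [FaithfulSMul k A] [FaithfulSMul A B] {n : ℕ} (hA : Algebra.trdeg k A = n)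
    (hB : Algebra.trdeg k B = n) : Algebra.IsAlgebraic A B := by
  rw [← trdeg_eq_zero_iff]
  have hadd := lift_trdeg_add_eq k A B
  rw [hA, hB, Cardinal.lift_natCast, Cardinal.lift_natCast] at hadd
  rw [← Cardinal.lift_eq_zero]
  exact (Cardinal.add_eq_left_iff.1 hadd).resolve_left fun h =>
    Cardinal.natCast_lt_aleph0.not_ge ((le_max_left _ _).trans h)

section Polynomial

variable {k F : Type*} [Field k] [Field F] [Algebra k F]
  [Algebra k[X] F] [IsScalarTower k k[X] F] [FaithfulSMul k[X] F]
  (htr : Algebra.trdeg k F = 1)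
include htr

theorem isAlgebraic_polynomial_of_trdeg_eq_one : Algebra.IsAlgebraic k[X] F :=
  isAlgebraic_of_trdeg_eq (n := 1)
    (by rw [Polynomial.trdeg_of_isDomain, Nat.cast_one]) (by rw [htr, Nat.cast_one])

variable [Algebra.EssFiniteType k F]

theorem finiteDimensional_fractionRing_of_trdeg_eq_one :
    letI := FractionRing.liftAlgebra k[X] F
    FiniteDimensional (FractionRing k[X]) F := by
  let := FractionRing.liftAlgebra k[X] F
  have := isAlgebraic_polynomial_of_trdeg_eq_one htr
  have : Algebra.IsAlgebraic (FractionRing k[X]) F :=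
    .extendScalars (IsFractionRing.injective k[X] (FractionRing k[X]))
  have : Algebra.EssFiniteType (FractionRing k[X]) F := .of_comp k _ F
  exact Algebra.finite_of_essFiniteType_of_isAlgebraic

variable [Finite k]

theorem finite_integralClosure_of_trdeg_eq_one : Module.Finite k[X] (integralClosure k[X] F) := by
  let := FractionRing.liftAlgebra k[X] F
  have := finiteDimensional_fractionRing_of_trdeg_eq_one htr
  exact finite_integralClosure_polynomial k (FractionRing k[X]) F

theorem isArithmeticSubring_integralClosure_of_trdeg_eq_one :
    IsArithmeticSubring (integralClosure k[X] F).toSubring := by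
  let := FractionRing.liftAlgebra k[X] F
  have := finiteDimensional_fractionRing_of_trdeg_eq_one htr
  have := finite_integralClosure_polynomial k (FractionRing k[X]) F
  exact ⟨isDedekindDomain_integralClosure_of_finite k[X] (FractionRing k[X]) F,
    IsIntegralClosure.isFractionRing_of_finite_extension k[X] (FractionRing k[X]) F
      (integralClosure k[X] F),
    Ring.HasFiniteQuotients.of_module_finite k[X] (integralClosure k[X] F),
    finite_classGroup_integralClosure_polynomial k (FractionRing k[X]) F⟩

end Polynomial

variable {k F : Type*} [Field k] [Field F] [Algebra k F]

variable (k) in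
/-- The ring of the elements of `F` that are integral over `k[x]`. It consists of the elements
whose poles are poles of `x`. -/
def integralOver (x : F) : Subring F :=
  letI := (aeval x : k[X] →ₐ[k] F).toRingHom.toAlgebra
  (integralClosure k[X] F).toSubring

theorem aeval_mem_integralOver (x : F) (f : k[X]) : aeval x f ∈ integralOver k x :=
  letI := (aeval x : k[X] →ₐ[k] F).toRingHom.toAlgebra
  isIntegral_algebraMap (R := k[X]) (x := f)

theorem algebraMap_mem_valuationSubring [Finite k] (V : ValuationSubring F) (a : k) :
    algebraMap k F a ∈ V :=
  mem_valuationSubring_of_isIntegral (A := ℤ) V (fun n => by simp)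
    ((Algebra.IsIntegral.isIntegral a).algebraMap)

theorem mem_valuationSubring_of_isAlgebraic [Finite k] (V : ValuationSubring F) {x : F}
    (hx : IsAlgebraic k x) : x ∈ V :=
  mem_valuationSubring_of_isIntegral V (algebraMap_mem_valuationSubring V) hx.isIntegral

theorem integralOver_le_valuationSubring [Finite k] {V : ValuationSubring F} {x : F}
    (hx : x ∈ V) : integralOver k x ≤ V.toSubring := by
  let := (aeval x : k[X] →ₐ[k] F).toRingHom.toAlgebra
  refine fun z hz => mem_valuationSubring_of_isIntegral (A := k[X]) V (fun f => ?_) hz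
  rw [show algebraMap k[X] F f = aeval x f from rfl, aeval_eq_sum_range]
  refine sum_mem fun i _ => ?_
  rw [Algebra.smul_def]
  exact mul_mem (algebraMap_mem_valuationSubring V _) (pow_mem hx i)

section Transcendental

variable (htr : Algebra.trdeg k F = 1) {x : F}
  (hx : Transcendental k x)
include htr hx
theorem exists_aeval_mul_mem_integralOver (z : F) :
    ∃ f : k[X], f ≠ 0 ∧ aeval x f * z ∈ integralOver k x := by
  let := (aeval x : k[X] →ₐ[k] F).toRingHom.toAlgebra
  have : IsScalarTower k k[X] F := .of_algebraMap_eq fun a => (aeval_C x a).symm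
  have : FaithfulSMul k[X] F :=
    (faithfulSMul_iff_algebraMap_injective _ _).2 (transcendental_iff_injective.1 hx)
  have := isAlgebraic_polynomial_of_trdeg_eq_one htr
  obtain ⟨f, hf, h⟩ := (Algebra.IsAlgebraic.isAlgebraic (R := k[X]) z).exists_integral_multiple
  exact ⟨f, hf, Algebra.smul_def f z ▸ h⟩

variable [Algebra.EssFiniteType k F] [Finite k]

theorem isArithmeticSubring_integralOver : IsArithmeticSubring (integralOver k x) := by
  let := (aeval x : k[X] →ₐ[k] F).toRingHom.toAlgebra
  have : IsScalarTower k k[X] F := .of_algebraMap_eq fun a => (aeval_C x a).symm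
  have : FaithfulSMul k[X] F :=
    (faithfulSMul_iff_algebraMap_injective _ _).2 (transcendental_iff_injective.1 hx)
  exact isArithmeticSubring_integralClosure_of_trdeg_eq_one htr

theorem exists_basis_integralOver : ∃ (n : ℕ) (b : Fin n → F),
    (∀ i, b i ∈ integralOver k x) ∧
      ∀ z ∈ integralOver k x, ∃ f : Fin n → k[X], z = ∑ i, aeval x (f i) * b i := by
  let := (aeval x : k[X] →ₐ[k] F).toRingHom.toAlgebra
  have : IsScalarTower k k[X] F := .of_algebraMap_eq fun a => (aeval_C x a).symm
  have : FaithfulSMul k[X] F :=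
    (faithfulSMul_iff_algebraMap_injective _ _).2 (transcendental_iff_injective.1 hx)
  have := finite_integralClosure_of_trdeg_eq_one (k := k) (F := F) htr
  obtain ⟨n, b, hb⟩ := Module.Finite.exists_fin (R := k[X]) (M := integralClosure k[X] F)
  refine ⟨n, fun i => b i, fun i => (b i).2, fun z hz => ?_⟩
  obtain ⟨f, hf⟩ := (Submodule.mem_span_range_iff_exists_fun k[X]).1
    (hb ▸ Submodule.mem_top : (⟨z, hz⟩ : integralClosure k[X] F) ∈ _)
  refine ⟨f, (congrArg Subtype.val hf).symm.trans ?_⟩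
  rw [AddSubmonoidClass.coe_finsetSum]
  exact Finset.sum_congr rfl fun i _ => Algebra.smul_def (f i) (b i : F)

end Transcendental

end FunctionField

/-! ### Class groups and units of function fields -/

section FunctionField

open Polynomial

variable {k F : Type*} [Field k] [Field F] [Algebra k F]

theorem exists_transcendental_of_trdeg_eq_one (htr : Algebra.trdeg k F = 1) :
    ∃ x : F, Transcendental k x := by
  by_contra! h
  have : Algebra.IsAlgebraic k F := ⟨fun x => not_not.1 (h x)⟩
  rw [trdeg_eq_zero] at htr
  exact zero_ne_one htr

theorem transcendental_inv {x : F} (hx : Transcendental k x) : Transcendental k x⁻¹ :=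
  fun h => hx (inv_inv x ▸ h.inv)

theorem exists_transcendental_mem_valuationSubring (htr : Algebra.trdeg k F = 1)
    (V : ValuationSubring F) : ∃ x ∈ V, Transcendental k x := by
  obtain ⟨x, hx⟩ := exists_transcendental_of_trdeg_eq_one htr
  rcases V.mem_or_inv_mem x with h | h
  · exact ⟨x, h, hx⟩
  · exact ⟨x⁻¹, h, transcendental_inv hx⟩

theorem FinitePlace.mem_ring_of_isAlgebraic [Finite k] (w : FinitePlace F) {x : F}
    (hx : IsAlgebraic k x) : x ∈ w.ring :=
  mem_valuationSubring_of_isAlgebraic w.ring hx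

section Finiteness

variable [Finite k] [Algebra.EssFiniteType k F] (htr : Algebra.trdeg k F = 1)
include htr

theorem exists_isArithmeticSubring_le_valuationSubring (V : ValuationSubring F) :
    ∃ R : Subring F, IsArithmeticSubring R ∧ R ≤ V.toSubring := by
  obtain ⟨x, hxV, hx⟩ := exists_transcendental_mem_valuationSubring htr V
  exact ⟨_, isArithmeticSubring_integralOver htr hx, integralOver_le_valuationSubring hxV⟩

theorem exists_finitePlace_ring_eq_of_trdeg_eq_one {V : ValuationSubring F} (hV : V ≠ ⊤) :
    ∃ w : FinitePlace F, w.ring = V := by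
  obtain ⟨R, hR, hRV⟩ := exists_isArithmeticSubring_le_valuationSubring htr V
  obtain ⟨v, hv⟩ := exists_placeOfPrime_ring_eq (R := R) V hV fun r => hRV r.2
  exact ⟨_, hv⟩

theorem finite_setOf_ord_ne_zero_of_trdeg_eq_one (y : Fˣ) :
    {w : FinitePlace F | w.ord y ≠ 0}.Finite := by
  obtain ⟨x, hx⟩ := exists_transcendental_of_trdeg_eq_one htr
  have := isArithmeticSubring_integralOver htr hx
  have := isArithmeticSubring_integralOver htr (transcendental_inv hx)
  refine ((finite_setOf_algebraMap_mem_and_ord_ne_zero (integralOver k x) y).union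
    (finite_setOf_algebraMap_mem_and_ord_ne_zero (integralOver k x⁻¹) y)).subset fun w hw => ?_
  exact (w.ring.mem_or_inv_mem x).imp
    (fun h => ⟨fun r => integralOver_le_valuationSubring h r.2, hw⟩)
    (fun h => ⟨fun r => integralOver_le_valuationSubring h r.2, hw⟩)

theorem isAlgebraic_of_forall_mem_ring {x : F} (hx : ∀ w : FinitePlace F, x ∈ w.ring) :
    IsAlgebraic k x := by
  have h : x ∈ (⨅ V : {V : ValuationSubring F // (∅ : Set F) ⊆ V.toSubring}, V.1.toSubring) := by
    rw [Subring.mem_iInf]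
    rintro ⟨V, -⟩
    rcases eq_or_ne V ⊤ with rfl | hV
    · exact ValuationSubring.mem_top x
    · obtain ⟨w, rfl⟩ := exists_finitePlace_ring_eq_of_trdeg_eq_one htr hV
      exact hx w
  rw [iInf_valuationSubring_superset] at h
  have hle : (integralClosure (Subring.closure (∅ : Set F)) F).toSubring ≤
      (integralClosure k F).toSubring :=
    have : IsIntegrallyClosedIn (integralClosure k F).toSubring F :=
      inferInstanceAs (IsIntegrallyClosedIn (integralClosure k F) F)
    Subring.integralClosure_subring_le_iff.2 (Subring.closure_le.2 (Set.empty_subset _))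
  exact IsIntegral.isAlgebraic (hle h)

theorem finite_algebraicClosure (w : FinitePlace F) : Finite (algebraicClosure k F) := by
  obtain ⟨R, hR, hRw⟩ := exists_isArithmeticSubring_le_valuationSubring htr w.ring
  have := hasFiniteQuotients_ring (R := R) w fun r => hRw r.2
  have : Finite (IsLocalRing.ResidueField w.ring) :=
    Ring.HasFiniteQuotients.finiteQuotient (IsDiscreteValuationRing.not_a_field w.ring)
  let φ : algebraicClosure k F →+* w.ring :=
    (algebraicClosure k F).val.toRingHom.codRestrict w.ring.toSubring fun x =>
      w.mem_ring_of_isAlgebraic (mem_algebraicClosure_iff.1 x.2)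
  exact Finite.of_injective _ ((IsLocalRing.residue w.ring).comp φ).injective

theorem finite_setOf_notMem_ring (x : F) : {w : FinitePlace F | x ∉ w.ring}.Finite := by
  rcases eq_or_ne x 0 with rfl | hx
  · exact Set.finite_empty.subset fun w hw => hw (zero_mem w.ring)
  · refine (finite_setOf_ord_ne_zero_of_trdeg_eq_one htr (Units.mk0 x hx)).subset fun w hw => ?_
    exact (not_le.1 ((w.mem_ring_iff (Units.mk0 x hx)).not.1 hw)).ne

end Finiteness

section Cohomology

/-- The ring of the elements of `F` that are regular at all poles of `x`. -/
def regularAtPoles (x : F) : Subring F := sIntegers (Sum.inl '' {w : FinitePlace F | x ∈ w.ring})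

theorem mem_regularAtPoles {x z : F} :
    z ∈ regularAtPoles x ↔ ∀ w : FinitePlace F, x ∉ w.ring → z ∈ w.ring :=
  forall_congr' fun w => by rw [Sum.inl_injective.mem_set_image]; rfl

variable (k) in
/-- The sum of the functions regular outside the poles of `x` and of those regular at the poles of
`x`. The quotient of `F` by this group is the first cohomology group of the structure sheaf of the
curve with function field `F`, computed by a covering by two affine open sets. -/
def coboundaries (x : F) : AddSubgroup F :=
  (integralOver k x).toAddSubgroup ⊔ (regularAtPoles x).toAddSubgroup

theorem FinitePlace.aeval_div_aeval_mem_ring [Finite k] (w : FinitePlace F) {x : F}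
    (hx : x ∉ w.ring) {f g : k[X]} (hg : g ≠ 0) (h : f.degree < g.degree) :
    aeval x f / aeval x g ∈ w.ring := by
  rcases eq_or_ne f 0 with rfl | hf
  · rw [map_zero, zero_div]
    exact zero_mem _
  set u := w.ring.valuation
  have hc (a : k) : u (algebraMap k F a) ≤ 1 :=
    (w.ring.valuation_le_one_iff _).2 (algebraMap_mem_valuationSubring w.ring a)
  have : u.IsTrivialOn k := ⟨fun a ha => by
    refine le_antisymm (hc a) ?_
    have h1 := hc a⁻¹
    rw [map_inv₀, map_inv₀] at h1
    refine (inv_le_one₀ (zero_lt_iff.2 ((Valuation.ne_zero_iff _).2 ?_))).1 h1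
    exact (map_ne_zero_iff _ (algebraMap k F).injective).2 ha⟩
  have hx1 : 1 < u x := not_le.1 fun h => hx ((w.ring.valuation_le_one_iff x).1 h)
  rw [← w.ring.valuation_le_one_iff, map_div₀,
    valuation_aeval_eq_valuation_X_pow_natDegree_of_one_lt_valuation_X x hx1 hf,
    valuation_aeval_eq_valuation_X_pow_natDegree_of_one_lt_valuation_X x hx1 hg]
  refine (div_le_one₀ (pow_pos (zero_lt_one.trans hx1) _)).2 ?_
  exact pow_le_pow_right₀ hx1.le (natDegree_le_natDegree h.le)

theorem exists_X_pow_mul_eq (u : k[X]) {v : k[X]} (hv : v ≠ 0) (M : ℕ) :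
    ∃ q r s : k[X], X ^ M * u = v * (X ^ M * q + r) + s ∧ r ∈ degreeLT k M ∧
      s.degree < v.degree := by
  refine ⟨X ^ M * u / v / X ^ M, X ^ M * u / v % X ^ M, X ^ M * u % v, ?_, ?_, ?_⟩
  · rw [EuclideanDomain.div_add_mod, EuclideanDomain.div_add_mod]
  · rw [mem_degreeLT]
    exact (degree_mod_lt _ (pow_ne_zero M X_ne_zero)).trans_eq (degree_X_pow M)
  · exact degree_mod_lt _ hv

theorem exists_sub_mem_coboundaries [Finite k] {x : F} (hx : Transcendental k x) (u : k[X])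
    {v : k[X]} (hv : v ≠ 0) {b : F} (hb : b ∈ integralOver k x) {M : ℕ}
    (hbM : b / x ^ M ∈ regularAtPoles x) : ∃ r ∈ degreeLT k M,
      aeval x u / aeval x v * b - aeval x r * (b / x ^ M) ∈ coboundaries k x := by
  obtain ⟨q, r, s, hqrs, hr, hs⟩ := exists_X_pow_mul_eq u hv M
  refine ⟨r, hr, ?_⟩
  have hx0 : x ≠ 0 := fun h => hx (h ▸ isAlgebraic_zero)
  have hv0 : aeval x v ≠ 0 := fun h => hx ⟨v, hv, h⟩
  have hsum : aeval x u / aeval x v * b - aeval x r * (b / x ^ M) =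
      aeval x q * b + aeval x s / aeval x v * (b / x ^ M) := by
    have h := congrArg (aeval x) hqrs
    simp only [map_mul, map_add, map_pow, aeval_X] at h
    field_simp
    linear_combination b * h
  rw [hsum]
  refine AddSubgroup.add_mem_sup
    ((integralOver k x).mul_mem (aeval_mem_integralOver x q) hb)
    ((regularAtPoles x).mul_mem ?_ hbM)
  exact mem_regularAtPoles.2 fun w hw => w.aeval_div_aeval_mem_ring hw hv hs

theorem FinitePlace.eventually_div_pow_mem_ring (w : FinitePlace F) {x : F} (hx : x ∉ w.ring)
    (b : F) : ∀ᶠ n in Filter.atTop, b / x ^ n ∈ w.ring := by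
  have hx0 : x ≠ 0 := fun h => hx (h ▸ zero_mem w.ring)
  rcases eq_or_ne b 0 with rfl | hb
  · exact .of_forall fun n => by rw [zero_div]; exact zero_mem _
  · refine Filter.eventually_atTop.2 ⟨(-w.ord (Units.mk0 b hb)).toNat, fun n hn => ?_⟩
    have hord := (w.mem_ring_iff (Units.mk0 x hx0)).not.1 hx
    refine w.div_mem_ring_of_ord_le (a := Units.mk0 x hx0 ^ n) (b := Units.mk0 b hb) ?_
    rw [w.ord_pow]
    nlinarith [Int.self_le_toNat (-w.ord (Units.mk0 b hb))]

variable [Finite k] [Algebra.EssFiniteType k F] (htr : Algebra.trdeg k F = 1)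
include htr

theorem exists_forall_div_pow_mem_regularAtPoles (x : F) {n : ℕ} (b : Fin n → F) :
    ∃ M : ℕ, ∀ i, b i / x ^ M ∈ regularAtPoles x := by
  have h : ∀ᶠ m in Filter.atTop, ∀ w ∈ {w : FinitePlace F | x ∉ w.ring}, ∀ i,
      b i / x ^ m ∈ w.ring :=
    (Filter.eventually_all_finite (finite_setOf_notMem_ring htr x)).2 fun w hw =>
      Filter.eventually_all.2 fun i => w.eventually_div_pow_mem_ring hw (b i)
  obtain ⟨M, hM⟩ := h.exists
  exact ⟨M, fun i => mem_regularAtPoles.2 fun w hw => hM w hw i⟩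

theorem finite_quotient_coboundaries {x : F} (hx : Transcendental k x) :
    Finite (F ⧸ coboundaries k x) := by
  obtain ⟨n, b, hb, hspan⟩ := exists_basis_integralOver htr hx
  obtain ⟨M, hM⟩ := exists_forall_div_pow_mem_regularAtPoles htr x b
  have : Finite (degreeLT k M) := .of_equiv _ (degreeLTEquiv k M).symm.toEquiv
  refine Finite.of_surjective (fun r : Fin n → degreeLT k M =>
    ((∑ i, aeval x (r i : k[X]) * (b i / x ^ M) : F) : F ⧸ coboundaries k x)) fun a => ?_
  obtain ⟨a, rfl⟩ := QuotientAddGroup.mk_surjective a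
  obtain ⟨v, hv, hva⟩ := exists_aeval_mul_mem_integralOver htr hx a
  obtain ⟨u, hu⟩ := hspan _ hva
  choose r hr hmem using fun i => exists_sub_mem_coboundaries hx (u i) hv (hb i) (hM i)
  refine ⟨fun i => ⟨r i, hr i⟩, ?_⟩
  rw [QuotientAddGroup.eq]
  have ha : a = ∑ i, aeval x (u i) / aeval x v * b i := by
    rw [← mul_right_inj' (fun h => hx ⟨v, hv, h⟩ : aeval x v ≠ 0), hu, Finset.mul_sum]
    refine Finset.sum_congr rfl fun i _ => ?_
    rw [← mul_assoc, mul_div_cancel₀ _ (fun h => hx ⟨v, hv, h⟩)]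
  rw [neg_add_eq_sub, ha, ← Finset.sum_sub_distrib]
  exact sum_mem fun i _ => hmem i

theorem exists_forall_mem_ring_iff_ne (w₀ : FinitePlace F) :
    ∃ c : F, ∀ w : FinitePlace F, c ∈ w.ring ↔ w ≠ w₀ := by
  obtain ⟨x, hxw₀, hx⟩ := exists_transcendental_mem_valuationSubring htr w₀.ring
  have := isArithmeticSubring_integralOver htr hx
  have hO {w : FinitePlace F} (hw : x ∈ w.ring) : integralOver k x ≤ w.ring.toSubring :=
    integralOver_le_valuationSubring hw
  obtain ⟨y, hy⟩ := exists_mem_ring_iff_ne_of_finite_classGroup (R := integralOver k x) w₀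
    fun r => hO hxw₀ r.2
  have := finite_quotient_coboundaries htr hx
  obtain ⟨m, n, hmn, h⟩ : ∃ m n : ℕ, m < n ∧ y ^ n - y ^ m ∈ coboundaries k x := by
    obtain ⟨m, n, hmn, h⟩ := Set.finite_univ.exists_lt_map_eq_of_forall_mem
      (f := fun n : ℕ => ((y ^ n : F) : F ⧸ coboundaries k x)) fun _ => Set.mem_univ _
    exact ⟨m, n, hmn, neg_add_eq_sub (y ^ m) (y ^ n) ▸ QuotientAddGroup.eq.1 h⟩
  obtain ⟨r, hr, z, hz, hrz⟩ := AddSubgroup.mem_sup.1 h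
  have hzr : z = y ^ n - y ^ m - r := eq_sub_of_add_eq' hrz
  refine ⟨z, fun w => ⟨?_, fun hw => ?_⟩⟩
  · rintro hzw rfl
    have hyw : 1 < w.ring.valuation y :=
      not_le.1 fun h => (hy w fun r => hO hxw₀ r.2).1 ((w.ring.valuation_le_one_iff y).1 h) rfl
    have hdiff : y ^ n - y ^ m ∈ w.ring := hrz ▸ add_mem (hO hxw₀ hr) hzw
    have hlt : w.ring.valuation (y ^ m) < w.ring.valuation (y ^ n) := by
      rw [map_pow, map_pow]
      exact pow_lt_pow_right₀ hyw hmn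
    rw [← w.ring.valuation_le_one_iff, Valuation.map_sub_eq_of_lt_left _ hlt, map_pow] at hdiff
    exact (one_lt_pow₀ hyw (Nat.ne_zero_of_lt hmn)).not_ge hdiff
  · by_cases hxw : x ∈ w.ring
    · have hyw := (hy w fun r => hO hxw r.2).2 hw
      exact hzr ▸ sub_mem (sub_mem (pow_mem hyw n) (pow_mem hyw m)) (hO hxw hr)
    · exact mem_regularAtPoles.1 hz w hxw

theorem exists_isArithmeticSubring_of_trdeg_eq_one (w₀ : FinitePlace F) :
    ∃ R : Subring F, IsArithmeticSubring R ∧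
      ∀ w : FinitePlace F, w ≠ w₀ → R ≤ w.ring.toSubring := by
  obtain ⟨c, hc⟩ := exists_forall_mem_ring_iff_ne htr w₀
  have hct : Transcendental k c := fun h => (hc w₀).1 (w₀.mem_ring_of_isAlgebraic h) rfl
  exact ⟨_, isArithmeticSubring_integralOver htr hct,
    fun w hw => integralOver_le_valuationSubring ((hc w).2 hw)⟩

end Cohomology

end FunctionField

/-! ### Global fields -/

section GlobalField

open Polynomial

theorem trdeg_ratFunc (k : Type*) [Field k] : Algebra.trdeg k (RatFunc k) = 1 := by
  have : Algebra.IsAlgebraic k[X] (RatFunc k) :=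
    IsLocalization.isAlgebraic _ (nonZeroDivisors k[X])
  rw [← trdeg_add_eq k k[X] (A := RatFunc k), trdeg_eq_zero (R := k[X]), trdeg_of_isDomain,
    add_zero]

theorem essFiniteType_ratFunc (k : Type*) [Field k] : Algebra.EssFiniteType k (RatFunc k) :=
  have : Algebra.EssFiniteType k[X] (RatFunc k) := .of_isLocalization _ (nonZeroDivisors k[X])
  .comp k k[X] (RatFunc k)

variable {F : Type*} [Field F]

theorem isEmpty_infinitePlace_of_charP (p : ℕ) [Fact p.Prime] [CharP F p] :
    IsEmpty (NumberField.InfinitePlace F) := by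
  refine ⟨fun w => ?_⟩
  have : CharP ℂ p := charP_of_injective_ringHom w.embedding.injective p
  exact (Fact.out : p.Prime).ne_zero (CharP.eq ℂ this (CharP.ofCharZero ℂ))

theorem FinitePlace.algebraMap_ringOfIntegers_mem_ring (w : FinitePlace F)
    (x : NumberField.RingOfIntegers F) : algebraMap (NumberField.RingOfIntegers F) F x ∈ w.ring :=
  mem_valuationSubring_of_isIntegral (A := ℤ) w.ring (fun n => by simp) x.2

theorem isArithmeticSubring_integralClosure_int [NumberField F] :
    IsArithmeticSubring (integralClosure ℤ F).toSubring where
  isDedekindDomain := inferInstanceAs (IsDedekindDomain (NumberField.RingOfIntegers F))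
  isFractionRing := inferInstanceAs (IsFractionRing (NumberField.RingOfIntegers F) F)
  hasFiniteQuotients := inferInstanceAs (Ring.HasFiniteQuotients (NumberField.RingOfIntegers F))
  finite_classGroup := inferInstanceAs (Finite (ClassGroup (NumberField.RingOfIntegers F)))

variable (F) in
/-- The group of the elements that are units at all finite places. -/
def everywhereUnits : Subgroup Fˣ := ⨅ w : FinitePlace F, w.ordHom.ker

theorem mem_everywhereUnits {x : Fˣ} :
    x ∈ everywhereUnits F ↔ ∀ w : FinitePlace F, w.ord x = 0 := by
  simp only [everywhereUnits, Subgroup.mem_iInf, MonoidHom.mem_ker, FinitePlace.ord, toAdd_eq_zero]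

theorem mem_ring_of_mem_everywhereUnits {x : Fˣ} (hx : x ∈ everywhereUnits F)
    (w : FinitePlace F) : (x : F) ∈ w.ring :=
  (w.mem_ring_iff x).2 (mem_everywhereUnits.1 hx w).ge

theorem everywhereUnits_le_range_units_map (R : Type*) [CommRing R] [IsDedekindDomain R]
    [Algebra R F] [IsFractionRing R F] :
    everywhereUnits F ≤ (Units.map (algebraMap R F : R →* F)).range := by
  have hmem (x : Fˣ) (hx : x ∈ everywhereUnits F) : ∃ r, algebraMap R F r = x :=
    exists_algebraMap_eq_of_forall_mem_ring R fun w _ => mem_ring_of_mem_everywhereUnits hx w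
  intro x hx
  obtain ⟨r, hr⟩ := hmem x hx
  obtain ⟨s, hs⟩ := hmem x⁻¹ (inv_mem hx)
  have hrs : r * s = 1 := IsFractionRing.injective R F (by
    rw [map_mul, hr, hs, map_one, ← Units.val_mul, mul_inv_cancel, Units.val_one])
  exact ⟨⟨r, s, hrs, by rw [mul_comm, hrs]⟩, Units.ext hr⟩

theorem finite_everywhereUnits_of_numberField [NumberField F] :
    Module.Finite ℤ (Additive (everywhereUnits F)) := by
  let f := Units.map
    (algebraMap (NumberField.RingOfIntegers F) F : NumberField.RingOfIntegers F →* F)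
  have : Module.Finite ℤ (Additive f.range) :=
    .of_surjective (MonoidHom.toAdditive f.rangeRestrict).toIntLinearMap f.rangeRestrict_surjective
  have hle := everywhereUnits_le_range_units_map (F := F) (NumberField.RingOfIntegers F)
  exact .of_injective (MonoidHom.toAdditive (Subgroup.inclusion hle)).toIntLinearMap
    (Subgroup.inclusion_injective hle)

theorem finite_everywhereUnits_of_trdeg_eq_one {k : Type*} [Field k] [Finite k] [Algebra k F]
    [Algebra.EssFiniteType k F] (htr : Algebra.trdeg k F = 1) : Finite (everywhereUnits F) := by
  have hne : Nonempty (FinitePlace F) := by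
    by_contra! hne
    obtain ⟨x, hx⟩ := exists_transcendental_of_trdeg_eq_one htr
    exact hx (isAlgebraic_of_forall_mem_ring htr fun w => isEmptyElim w)
  have := finite_algebraicClosure htr (Classical.arbitrary (FinitePlace F))
  refine Finite.of_injective (β := algebraicClosure k F) (fun x => ⟨x.1, mem_algebraicClosure_iff.2
    (isAlgebraic_of_forall_mem_ring htr (mem_ring_of_mem_everywhereUnits x.2))⟩) ?_
  exact fun x y hxy => Subtype.ext (Units.ext (congrArg Subtype.val hxy))

namespace IsGlobalField

theorem numberField_or_trdeg_eq_one (hF : IsGlobalField F) :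
    NumberField F ∨ ∃ (p : ℕ) (_ : Fact p.Prime) (_ : Algebra (ZMod p) F),
      Algebra.EssFiniteType (ZMod p) F ∧ Algebra.trdeg (ZMod p) F = 1 := by
  refine hF.imp_right ?_
  rintro ⟨p, hp, hQ, hfin⟩
  let : Algebra (ZMod p) F :=
    ((algebraMap (RatFunc (ZMod p)) F).comp (algebraMap (ZMod p) (RatFunc (ZMod p)))).toAlgebra
  have : IsScalarTower (ZMod p) (RatFunc (ZMod p)) F := .of_algebraMap_eq fun _ => rfl
  have := essFiniteType_ratFunc (ZMod p)
  refine ⟨p, hp, inferInstance, .comp _ (RatFunc (ZMod p)) _, ?_⟩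
  have h := lift_trdeg_add_eq (ZMod p) (RatFunc (ZMod p)) F
  rw [trdeg_eq_zero (R := RatFunc (ZMod p)), trdeg_ratFunc] at h
  simpa using h.symm

theorem of_finiteDimensional {k K : Type*} [Field k] [Field K] [Algebra k K]
    [FiniteDimensional k K] (hk : IsGlobalField k) : IsGlobalField K := by
  rcases hk with h | ⟨p, hp, hQ, hfin⟩
  · exact Or.inl (NumberField.of_module_finite k K)
  · let : Algebra (RatFunc (ZMod p)) K :=
      ((algebraMap k K).comp (algebraMap (RatFunc (ZMod p)) k)).toAlgebra
    have : IsScalarTower (RatFunc (ZMod p)) k K := .of_algebraMap_eq fun _ => rfl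
    exact Or.inr ⟨p, hp, inferInstance, FiniteDimensional.trans _ k K⟩

theorem finite_infinitePlace (hF : IsGlobalField F) :
    Finite (NumberField.InfinitePlace F) := by
  rcases hF.numberField_or_trdeg_eq_one with h | ⟨p, _, _, _, -⟩
  · infer_instance
  · have := charP_of_injective_algebraMap (algebraMap (ZMod p) F).injective p
    have := isEmpty_infinitePlace_of_charP (F := F) p
    infer_instance

theorem finite_setOf_ord_ne_zero (hF : IsGlobalField F) (x : Fˣ) :
    {w : FinitePlace F | w.ord x ≠ 0}.Finite := by
  rcases hF.numberField_or_trdeg_eq_one with h | ⟨p, _, _, _, htr⟩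
  · exact (finite_setOf_algebraMap_mem_and_ord_ne_zero (NumberField.RingOfIntegers F) x).subset
      fun w hw => ⟨w.algebraMap_ringOfIntegers_mem_ring, hw⟩
  · exact finite_setOf_ord_ne_zero_of_trdeg_eq_one htr x

theorem finite_everywhereUnits (hF : IsGlobalField F) :
    Module.Finite ℤ (Additive (everywhereUnits F)) := by
  rcases hF.numberField_or_trdeg_eq_one with h | ⟨p, _, _, _, htr⟩
  · exact finite_everywhereUnits_of_numberField
  · have : Finite (Additive (everywhereUnits F)) := finite_everywhereUnits_of_trdeg_eq_one htr
    infer_instance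

theorem exists_isArithmeticSubring (hF : IsGlobalField F) {S : Set (Place F)} (hS : S.Nonempty) :
    ∃ R : Subring F, IsArithmeticSubring R ∧
      ∀ w : FinitePlace F, Sum.inl w ∉ S → R ≤ w.ring.toSubring := by
  rcases hF.numberField_or_trdeg_eq_one with h | ⟨p, _, _, _, htr⟩
  · exact ⟨_, isArithmeticSubring_integralClosure_int,
      fun w _ x hx => w.algebraMap_ringOfIntegers_mem_ring ⟨x, hx⟩⟩
  · have := charP_of_injective_algebraMap (algebraMap (ZMod p) F).injective p
    have := isEmpty_infinitePlace_of_charP (F := F) p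
    obtain ⟨w₀ | w₀, hw₀⟩ := hS
    · obtain ⟨R, hR, h⟩ := exists_isArithmeticSubring_of_trdeg_eq_one htr w₀
      exact ⟨R, hR, fun w hw => h w fun e => hw (e ▸ hw₀)⟩
    · exact isEmptyElim w₀

end IsGlobalField

end GlobalField

/-! ### Finiteness of ray class groups and ray units -/

section Divisors

variable {F : Type*} [Field F] {R : Type*} [CommRing R] [IsDedekindDomain R] [Algebra R F]
  [IsFractionRing R F]

theorem ord_placeOfPrime_algebraMap (v : HeightOneSpectrum R) (x : Fˣ) (r : R)
    (h : algebraMap R F r = x) :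
    (placeOfPrime F v).ord x = FractionalIdeal.count F v (Ideal.span {r} : Ideal R) := by
  have hr : r ≠ 0 := by
    rintro rfl
    rw [map_zero] at h
    exact x.ne_zero h.symm
  have hI : Ideal.span {r} ≠ 0 := by simpa using hr
  have hval := valuation_eq_exp_neg_ord_placeOfPrime v x
  rw [← h, v.valuation_of_algebraMap, v.intValuation_if_neg hr, exp_inj, neg_inj] at hval
  rw [FractionalIdeal.count_coe F v hI, hval]

theorem ord_placeOfPrime_eq_count (v : HeightOneSpectrum R) (x : Fˣ) :
    (placeOfPrime F v).ord x =
      FractionalIdeal.count F v (FractionalIdeal.spanSingleton R⁰ (x : F)) := by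
  obtain ⟨r, s, hs, hrs⟩ := IsFractionRing.div_surjective (A := R) (x : F)
  have hs0 : algebraMap R F s ≠ 0 := IsFractionRing.to_map_ne_zero_of_mem_nonZeroDivisors hs
  have hr : algebraMap R F r = x * algebraMap R F s := by rw [← hrs, div_mul_cancel₀ _ hs0]
  have hords := ord_placeOfPrime_algebraMap v (Units.mk0 _ hs0) s rfl
  have hordr := ord_placeOfPrime_algebraMap v (x * Units.mk0 _ hs0) r hr
  rw [FractionalIdeal.coeIdeal_span_singleton] at hords hordr
  rw [hr, ← FractionalIdeal.spanSingleton_mul_spanSingleton, FractionalIdeal.count_mul,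
    FinitePlace.ord_mul, hords] at hordr
  · exact add_right_cancel hordr
  · exact FractionalIdeal.spanSingleton_ne_zero_iff.2 x.ne_zero
  · exact FractionalIdeal.spanSingleton_ne_zero_iff.2 hs0

variable (F) in
/-- The fractional ideal `∏ v ^ D v` of a divisor `D` on the height one spectrum. -/
def fractionalIdealOfDivisor (D : HeightOneSpectrum R →₀ ℤ) : (FractionalIdeal R⁰ F)ˣ :=
  Units.mk0 (D.prod fun v n => (v.asIdeal : FractionalIdeal R⁰ F) ^ n) <|
    Finset.prod_ne_zero_iff.2 fun v _ => zpow_ne_zero _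
      (FractionalIdeal.coeIdeal_ne_zero.2 v.ne_bot)

theorem count_fractionalIdealOfDivisor (D : HeightOneSpectrum R →₀ ℤ) (v : HeightOneSpectrum R) :
    FractionalIdeal.count F v (fractionalIdealOfDivisor F D : FractionalIdeal R⁰ F) = D v :=
  FractionalIdeal.count_finsuppProd F v D

variable (R) in
/-- The ideal class in `R` of a divisor of `F`; the places that do not come from primes of `R` are
disregarded. -/
def idealClass (D : FinitePlace F →₀ ℤ) : ClassGroup R :=
  ClassGroup.mk F (fractionalIdealOfDivisor F
    (D.comapDomain (placeOfPrime F) placeOfPrime_injective.injOn))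

theorem exists_forall_ord_eq_sub_of_idealClass_eq {D D' : FinitePlace F →₀ ℤ}
    (h : idealClass R D = idealClass R D') :
    ∃ x : Fˣ, ∀ w : FinitePlace F, (∀ r : R, algebraMap R F r ∈ w.ring) →
      w.ord x = D w - D' w := by
  rw [idealClass, idealClass, ← div_eq_one, ← map_div, ClassGroup.mk_eq_one_iff] at h
  obtain ⟨x, hx⟩ := (FractionalIdeal.isPrincipal_iff _).1 h
  have hx0 : x ≠ 0 := by
    rintro rfl
    rw [FractionalIdeal.spanSingleton_zero] at hx
    exact Units.ne_zero _ hx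
  refine ⟨Units.mk0 x hx0, fun w hw => ?_⟩
  obtain ⟨v, rfl⟩ := exists_placeOfPrime_eq w hw
  rw [ord_placeOfPrime_eq_count, Units.val_mk0, ← hx, div_eq_mul_inv, Units.val_mul,
    FractionalIdeal.count_mul _ _ (Units.ne_zero _) (Units.ne_zero _),
    Units.val_inv_eq_inv_val, FractionalIdeal.count_inv, count_fractionalIdealOfDivisor,
    count_fractionalIdealOfDivisor, ← sub_eq_add_neg, Finsupp.comapDomain_apply,
    Finsupp.comapDomain_apply]

end Divisors

section Quotients

@[to_additive finite_addQuotient_of_forall_eq]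
theorem finite_quotient_of_forall_eq {A T : Type*} [Group A] [Finite T] (H : Subgroup A)
    (f : A → T) (hf : ∀ a b, f a = f b → a⁻¹ * b ∈ H) : Finite (A ⧸ H) := by
  refine Finite.of_injective (fun q : A ⧸ H => f q.out) fun q q' h => ?_
  rw [← q.out_eq, ← q'.out_eq]
  exact QuotientGroup.eq.2 (hf _ _ h)

theorem isNoetherian_quotient_of_le_ker {R A B : Type*} [Ring R] [AddCommGroup A] [Module R A]
    [AddCommGroup B] [Module R B] [IsNoetherian R B] (f : A →ₗ[R] B) {M : Submodule R A}
    (hM : M ≤ LinearMap.ker f)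
    [IsNoetherian R (LinearMap.ker f ⧸ M.comap (LinearMap.ker f).subtype)] :
    IsNoetherian R (A ⧸ M) :=
  isNoetherian_of_range_eq_ker
    ((M.comap (LinearMap.ker f).subtype).mapQ M (LinearMap.ker f).subtype (le_refl (M.comap _)))
    (M.liftQ f hM) <| by
      rw [Submodule.range_mapQ, Submodule.range_subtype, Submodule.ker_liftQ]

end Quotients

section Finiteness

variable {F : Type*} [Field F]

theorem mem_span_singleton_iff_div_mem (V : ValuationSubring F) {a : F} (ha : a ≠ 0) (x : F) :
    x ∈ Submodule.span V {a} ↔ x / a ∈ V := by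
  rw [Submodule.mem_span_singleton]
  constructor
  · rintro ⟨c, rfl⟩
    rw [show c • a = (c : F) * a from rfl, mul_div_cancel_right₀ _ ha]
    exact c.2
  · exact fun h => ⟨⟨x / a, h⟩, div_mul_cancel₀ x ha⟩

/-- The vector of the orders at the places in `T`, as a `ℤ`-linear map. -/
def ordLinearMap (T : Set (FinitePlace F)) : Additive Fˣ →ₗ[ℤ] (T → ℤ) :=
  AddMonoidHom.toIntLinearMap
    { toFun := fun x w => w.1.ord (Additive.toMul x)
      map_zero' := funext fun w => w.1.ord_one
      map_add' := fun _ _ => funext fun w => w.1.ord_mul _ _ }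

theorem mem_ker_ordLinearMap {T : Set (FinitePlace F)} {x : Additive Fˣ} :
    x ∈ LinearMap.ker (ordLinearMap T) ↔ ∀ w ∈ T, w.ord (Additive.toMul x) = 0 :=
  LinearMap.mem_ker.trans (funext_iff.trans Subtype.forall)

theorem pos_inv_mul_of_pos_iff_pos {a b : ℝ} (ha : a ≠ 0) (hb : b ≠ 0) (h : 0 < a ↔ 0 < b) :
    0 < a⁻¹ * b := by
  rcases ha.lt_or_gt with ha' | ha'
  · exact mul_pos_of_neg_of_neg (inv_lt_zero.2 ha')
      (hb.lt_of_le (not_lt.1 fun hb' => ha'.not_gt (h.2 hb')))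
  · exact mul_pos (inv_pos.2 ha') (h.1 ha')

theorem ord_eq_zero_of_mem_sUnits {S : Set (Place F)} {x : Fˣ} (hx : x ∈ sUnits S)
    {w : FinitePlace F} (hw : Sum.inl w ∉ S) : w.ord x = 0 := by
  have hpos := (w.mem_ring_iff _).1 (hx.1 w hw)
  have hneg := (w.mem_ring_iff _).1 (hx.2 w hw)
  rw [w.ord_inv] at hneg
  omega

namespace SModulus

variable {S : Set (Place F)} (m : SModulus S)

theorem exists_mem_fin_ne_zero : ∃ a ∈ m.fin, (a : F) ≠ 0 := by
  obtain ⟨a, ha, h0⟩ := Submodule.exists_mem_ne_zero_of_ne_bot m.fin_ne_bot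
  exact ⟨a, ha, fun h => h0 (Subtype.ext h)⟩

theorem exists_localIdeal_eq_span_singleton {w : FinitePlace F} (hw : Sum.inl w ∉ S) :
    ∃ a ∈ m.fin, (a : F) ≠ 0 ∧ m.localIdeal w = Submodule.span w.ring {(a : F)} := by
  have hbdd : ∀ x : Fˣ, (∃ b ∈ m.fin, (b : F) = x) → 0 ≤ w.ord x := by
    rintro x ⟨b, -, hbx⟩
    exact (w.mem_ring_iff x).1 (hbx ▸ b.2 w hw)
  obtain ⟨b₀, hb₀, hb₀0⟩ := m.exists_mem_fin_ne_zero
  obtain ⟨_, ⟨x, ⟨a, ha, hax⟩, rfl⟩, hmin⟩ := Int.exists_least_of_bdd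
    (P := fun n => ∃ x : Fˣ, (∃ b ∈ m.fin, (b : F) = x) ∧ w.ord x = n)
    ⟨0, fun n ⟨x, hx, hn⟩ => hn ▸ hbdd x hx⟩ ⟨_, Units.mk0 (b₀ : F) hb₀0, ⟨b₀, hb₀, rfl⟩, rfl⟩
  refine ⟨a, ha, hax ▸ x.ne_zero, le_antisymm (Submodule.span_le.2 ?_) ?_⟩
  · rintro _ ⟨b, hb, rfl⟩
    rw [SetLike.mem_coe, hax, mem_span_singleton_iff_div_mem _ x.ne_zero]
    by_cases hb0 : (b : F) = 0
    · rw [hb0, zero_div]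
      exact zero_mem _
    · exact w.div_mem_ring_of_ord_le (b := Units.mk0 (b : F) hb0)
        (hmin _ ⟨_, ⟨b, hb, rfl⟩, rfl⟩)
  · exact (Submodule.span_singleton_le_iff_mem _ _).2 (Submodule.subset_span ⟨a, ha, rfl⟩)

/-- The elements of `Fˣ` that are units at all places dividing `𝔪_f`. -/
def localUnits : Subgroup Fˣ where
  carrier := {x | ∀ w, m.FinDvd w → w.ord x = 0}
  one_mem' w _ := w.ord_one
  mul_mem' hx hy w hw := by rw [w.ord_mul, hx w hw, hy w hw, add_zero]
  inv_mem' hx w hw := by rw [w.ord_inv, hx w hw, neg_zero]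

theorem mem_ring_of_mem_localUnits {x : Fˣ} (hx : x ∈ m.localUnits) {w : FinitePlace F}
    (hw : m.FinDvd w) : (x : F) ∈ w.ring :=
  (w.mem_ring_iff x).2 (hx w hw).ge

theorem rayGroup_le_localUnits : m.rayGroup ≤ m.localUnits := fun x hx w hw => by
  have hpos := (w.mem_ring_iff x).1 (m.mem_ring_of_sub_one_mem hw (hx.1 w hw))
  have hneg := m.inv_mem_ring_of_sub_one_mem hw (hx.1 w hw)
  rw [← Units.val_inv_eq_inv_val, w.mem_ring_iff, w.ord_inv] at hneg
  omega

theorem inv_mul_sub_one_mem_localIdeal {w : FinitePlace F} (hw : m.FinDvd w) {x y : Fˣ}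
    (hx : x ∈ m.localUnits) (hxy : (y : F) - x ∈ m.localIdeal w) :
    ((x⁻¹ * y : Fˣ) : F) - 1 ∈ m.localIdeal w := by
  have hmul : ((x⁻¹ * y : Fˣ) : F) - 1 = ((x⁻¹ : Fˣ) : F) * (y - x) := by
    rw [mul_sub, Units.inv_mul, Units.val_mul]
  rw [hmul]
  exact (m.localIdeal w).smul_mem ⟨_, m.mem_ring_of_mem_localUnits (inv_mem hx) hw⟩ hxy

variable (hF : IsGlobalField F)
include hF

theorem finite_setOf_finDvd : {w | m.FinDvd w}.Finite := by
  obtain ⟨a, ha, h0⟩ := m.exists_mem_fin_ne_zero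
  refine (hF.finite_setOf_ord_ne_zero (Units.mk0 a h0)).subset fun w hw => ?_
  exact ((w.mem_nonunits_iff (Units.mk0 (a : F) h0)).1 (hw.2 a ha)).ne'

theorem finite_unitGroup (hSf : S.Finite) : Module.Finite ℤ (Additive m.unitGroup) := by
  let T : Set (FinitePlace F) := Sum.inl ⁻¹' S
  have : Finite T := (hSf.preimage Sum.inl_injective.injOn).to_subtype
  let f := ordLinearMap T
  let toSubmodule (H : Subgroup Fˣ) : Submodule ℤ (Additive Fˣ) := H.toAddSubgroup.toIntSubmodule
  have hker : toSubmodule m.unitGroup ⊓ LinearMap.ker f ≤ toSubmodule (everywhereUnits F) := by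
    rintro x ⟨hx, hfx⟩
    refine mem_everywhereUnits.2 fun w => ?_
    by_cases hw : Sum.inl w ∈ S
    · exact mem_ker_ordLinearMap.1 hfx w hw
    · exact ord_eq_zero_of_mem_sUnits hx.1 hw
  have hfg : (toSubmodule (everywhereUnits F)).FG :=
    Module.Finite.iff_fg.1 hF.finite_everywhereUnits
  exact Module.Finite.iff_fg.2 (Submodule.fg_of_fg_map_of_fg_inf_ker f (IsNoetherian.noetherian _)
    (hfg.of_le hker))

variable (hS : S.Nonempty)
include hS

theorem finite_ring_quotient_localIdeal {w : FinitePlace F} (hw : Sum.inl w ∉ S) :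
    Finite (w.ring ⧸ (m.localIdeal w).comap (Algebra.linearMap w.ring F)) := by
  obtain ⟨R, hR, hRS⟩ := hF.exists_isArithmeticSubring hS
  have := hasFiniteQuotients_ring w (R := R) fun r => hRS w hw r.2
  obtain ⟨a, ha, h0⟩ := m.exists_mem_fin_ne_zero
  refine Ring.HasFiniteQuotients.finiteQuotient ((Submodule.ne_bot_iff _).2
    ⟨⟨a, a.2 w hw⟩, Submodule.subset_span ⟨a, ha, rfl⟩, fun h => h0 (congrArg Subtype.val h)⟩)

theorem finite_localUnits_quotient :
    Finite (m.localUnits ⧸ m.rayGroup.subgroupOf m.localUnits) := by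
  have := hF.finite_infinitePlace
  have := (m.finite_setOf_finDvd hF).to_subtype
  have (w : {w | m.FinDvd w}) := m.finite_ring_quotient_localIdeal hF hS w.2.1
  let residue (x : m.localUnits) (w : {w | m.FinDvd w}) :
      w.1.ring ⧸ (m.localIdeal w.1).comap (Algebra.linearMap w.1.ring F) :=
    Submodule.Quotient.mk ⟨(x : Fˣ), m.mem_ring_of_mem_localUnits x.2 w.2⟩
  let isPos (x : m.localUnits) (w : m.inf) : Prop :=
    0 < NumberField.InfinitePlace.embedding_of_isReal (m.isReal w.1 w.2) ((x : Fˣ) : F)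
  refine finite_quotient_of_forall_eq _ (fun x => (residue x, isPos x)) fun x y hxy =>
    ⟨fun w hw => ?_, fun w hw => ?_⟩
  · have hres : residue y ⟨w, hw⟩ = residue x ⟨w, hw⟩ := congrFun (congrArg Prod.fst hxy.symm) _
    exact m.inv_mul_sub_one_mem_localIdeal hw x.2
      ((Submodule.Quotient.eq ((m.localIdeal w).comap (Algebra.linearMap w.ring F))).1 hres)
  · have hpos : isPos x ⟨w, hw⟩ = isPos y ⟨w, hw⟩ := congrFun (congrArg Prod.snd hxy) _
    change 0 < NumberField.InfinitePlace.embedding_of_isReal (m.isReal w hw)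
      (((x : Fˣ)⁻¹ * (y : Fˣ) : Fˣ) : F)
    rw [Units.val_mul, map_mul, Units.val_inv_eq_inv_val, map_inv₀]
    exact pos_inv_mul_of_pos_iff_pos ((map_ne_zero _).2 (x : Fˣ).ne_zero)
      ((map_ne_zero _).2 (y : Fˣ).ne_zero) (iff_of_eq hpos)

/-- Dividing a divisor `D` by a chosen representative of its ideal class leaves the divisor of some
`x ∈ localUnits`; the ideal class of `D` and the class of `x` modulo `rayGroup` determine the ray
class of `D`. -/
theorem finite_classGroup : Finite m.ClassGroup := by
  obtain ⟨R, hR, hRS⟩ := hF.exists_isArithmeticSubring hS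
  have := m.finite_localUnits_quotient hF hS
  let cl (D : m.divisorGroup) : _root_.ClassGroup R := idealClass R D.1
  let rep : _root_.ClassGroup R → m.divisorGroup := Function.invFun cl
  have hgen (D : m.divisorGroup) : ∃ x : m.localUnits, ∀ w : FinitePlace F, Sum.inl w ∉ S →
      w.ord (x : Fˣ) = D.1 w - (rep (cl D)).1 w := by
    have hrep : cl (rep (cl D)) = cl D := Function.invFun_eq ⟨D, rfl⟩
    obtain ⟨x, hx⟩ := exists_forall_ord_eq_sub_of_idealClass_eq hrep.symm
    have hxS (w : FinitePlace F) (hw : Sum.inl w ∉ S) := hx w fun r => hRS w hw r.2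
    refine ⟨⟨x, fun w hw => ?_⟩, hxS⟩
    rw [hxS w hw.1, D.2 w (Or.inr hw), (rep (cl D)).2 w (Or.inr hw), sub_zero]
  choose x hx using hgen
  refine finite_addQuotient_of_forall_eq _ (fun D => (cl D,
    (x D : m.localUnits ⧸ m.rayGroup.subgroupOf m.localUnits))) fun D D' h => ?_
  obtain ⟨hcl, hmk⟩ := Prod.ext_iff.1 h
  refine ⟨_, Subgroup.mem_subgroupOf.1 (QuotientGroup.eq.1 hmk), fun w hw => ?_⟩
  rw [Subgroup.coe_mul, Subgroup.coe_inv, w.ord_mul, w.ord_inv, hx D w hw, hx D' w hw,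
    show cl D = cl D' from hcl]
  change -D.1 w + D'.1 w = _
  ring

theorem finite_quotient_rayGroup :
    Module.Finite ℤ (Additive Fˣ ⧸ (Subgroup.toAddSubgroup m.rayGroup).toIntSubmodule) := by
  have := (m.finite_setOf_finDvd hF).to_subtype
  have := m.finite_localUnits_quotient hF hS
  let f := ordLinearMap {w | m.FinDvd w}
  let M := (Subgroup.toAddSubgroup m.rayGroup).toIntSubmodule
  have hMf : M ≤ LinearMap.ker f := fun x hx =>
    mem_ker_ordLinearMap.2 fun w hw => m.rayGroup_le_localUnits hx w hw
  have : Finite (LinearMap.ker f ⧸ M.comap (LinearMap.ker f).subtype) :=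
    finite_addQuotient_of_forall_eq (M.comap (LinearMap.ker f).subtype).toAddSubgroup
      (fun x => ((⟨Additive.toMul x.1, mem_ker_ordLinearMap.1 x.2⟩ : m.localUnits) :
        m.localUnits ⧸ m.rayGroup.subgroupOf m.localUnits))
      fun _ _ h => QuotientGroup.eq.1 h
  have := isNoetherian_quotient_of_le_ker f hMf
  infer_instance

end SModulus

end Finiteness

/-! ### Places in extensions -/

theorem mem_nonunits_placeOfPrime_iff {F R : Type*} [Field F] [CommRing R] [IsDedekindDomain R]
    [Algebra R F] [IsFractionRing R F] (v : HeightOneSpectrum R) (r : R) :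
    algebraMap R F r ∈ (placeOfPrime F v).ring.nonunits ↔ r ∈ v.asIdeal := by
  rw [← v.valuation_lt_one_iff_mem (K := F)]
  by_cases hr : algebraMap R F r = 0
  · refine iff_of_true (by rw [ValuationSubring.mem_nonunits_iff_or]; exact Or.inl hr) ?_
    change v.valuation F (algebraMap R F r) < 1
    rw [hr, map_zero]
    exact zero_lt_one
  · have hord := (placeOfPrime F v).mem_nonunits_iff (Units.mk0 _ hr)
    have hval := valuation_eq_exp_neg_ord_placeOfPrime v (Units.mk0 _ hr)
    rw [Units.val_mk0] at hord hval
    rw [hord, hval, ← exp_zero, exp_lt_exp, neg_lt_zero]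

section Extension

variable {k K : Type*} [Field k] [Field K] [Algebra k K]

theorem exists_galRestrict_mem_iff {A : Type*} [CommRing A] [IsDomain A]
    [IsDiscreteValuationRing A] [Algebra A k] [IsFractionRing A k] [Algebra A K]
    [IsScalarTower A k K] [FiniteDimensional k K] [IsGalois k K]
    (P P' : HeightOneSpectrum (integralClosure A K)) :
    ∃ σ : K ≃ₐ[k] K, ∀ b,
      galRestrict A k K (integralClosure A K) σ b ∈ P'.asIdeal ↔ b ∈ P.asIdeal := by
  let B := integralClosure A K
  have : IsFractionRing B K := integralClosure.isFractionRing_of_finite_extension k K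
  have hinv : Algebra.IsInvariant A B (B ≃ₐ[A] B) := Algebra.isInvariant_of_isGalois' A k K B
  have : Finite (B ≃ₐ[A] B) := .of_equiv _ (galRestrict A k K B).toEquiv
  have hunder (P : HeightOneSpectrum B) : P.asIdeal.under A = IsLocalRing.maximalIdeal A := by
    have hne : P.asIdeal.under A ≠ ⊥ := Ideal.under_ne_bot A P.ne_bot
    exact IsLocalRing.eq_maximalIdeal (Ring.DimensionLEOne.maximalOfPrime hne inferInstance)
  obtain ⟨g, hg⟩ := hinv.exists_smul_of_under_eq A B (B ≃ₐ[A] B) P.asIdeal P'.asIdeal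
    ((hunder P).trans (hunder P').symm)
  refine ⟨(galRestrict A k K B).symm g, fun b => ?_⟩
  rw [MulEquiv.apply_symm_apply, hg]
  exact Ideal.smul_mem_pointwise_smul_iff (a := g)

namespace FinitePlace

section Algebraic

variable [Algebra.IsAlgebraic k K]

variable (k) in
theorem exists_algebraMap_notMem_ring (w : FinitePlace K) : ∃ a : k, algebraMap k K a ∉ w.ring := by
  by_contra! h
  refine w.ring_ne_top (top_le_iff.1 fun x _ => ?_)
  exact mem_valuationSubring_of_isIntegral w.ring h
    (Algebra.IsAlgebraic.isAlgebraic (R := k) x).isIntegral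

variable (k) in
/-- The place of `k` below a finite place of `K`. -/
def under (w : FinitePlace K) : FinitePlace k where
  ring := w.ring.comap (algebraMap k K)
  isDVR := w.isDVR_comap (w.exists_algebraMap_notMem_ring k).choose_spec

theorem mem_under_ring (w : FinitePlace K) (a : k) :
    a ∈ (w.under k).ring ↔ algebraMap k K a ∈ w.ring := Iff.rfl

theorem algebraMap_mem_nonunits_iff (w : FinitePlace K) (a : k) :
    algebraMap k K a ∈ w.ring.nonunits ↔ a ∈ (w.under k).ring.nonunits := by
  rw [ValuationSubring.mem_nonunits_iff_or, ValuationSubring.mem_nonunits_iff_or,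
    mem_under_ring, map_inv₀, map_eq_zero]

theorem liesOver_iff (w : FinitePlace K) (v : FinitePlace k) :
    LiesOver (Sum.inl w) (Sum.inl v) ↔ w.under k = v :=
  ⟨fun h => FinitePlace.ext h, fun h => h ▸ rfl⟩

theorem under_smul (σ : K ≃ₐ[k] K) (w : FinitePlace K) : (σ • w).under k = w.under k := by
  rw [← liesOver_iff, liesOver_smul, liesOver_iff]

theorem inl_mem_placesOver {S : Set (Place k)} (w : FinitePlace K) :
    Sum.inl w ∈ placesOver K S ↔ Sum.inl (w.under k) ∈ S := by
  constructor
  · rintro ⟨v | v, hv, h⟩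
    · rw [liesOver_iff] at h
      rwa [h]
    · exact h.elim
  · exact fun h => ⟨_, h, (liesOver_iff _ _).2 rfl⟩

theorem ord_map_pos (w : FinitePlace K) {x : kˣ} (hx : 0 < (w.under k).ord x) :
    0 < w.ord (Units.map (algebraMap k K : k →* K) x) :=
  (w.mem_nonunits_iff _).1 <| (w.algebraMap_mem_nonunits_iff (x : k)).2 <|
    ((w.under k).mem_nonunits_iff x).2 hx

theorem ord_map_nonneg (w : FinitePlace K) {x : kˣ} (hx : 0 ≤ (w.under k).ord x) :
    0 ≤ w.ord (Units.map (algebraMap k K : k →* K) x) :=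
  (w.mem_ring_iff _).1 (((w.under k).mem_ring_iff x).2 hx)

theorem ord_map_eq_zero (w : FinitePlace K) {x : kˣ} (hx : (w.under k).ord x = 0) :
    w.ord (Units.map (algebraMap k K : k →* K) x) = 0 := by
  have hinv := w.ord_map_nonneg (x := x⁻¹) (by rw [ord_inv, hx, neg_zero])
  rw [map_inv, ord_inv] at hinv
  exact le_antisymm (neg_nonneg.1 hinv) (w.ord_map_nonneg hx.ge)

variable (k) in
theorem exists_pos_ord_map_eq_mul (w : FinitePlace K) : ∃ e : ℤ, 0 < e ∧
    ∀ x : kˣ, w.ord (Units.map (algebraMap k K : k →* K) x) = e * (w.under k).ord x := by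
  obtain ⟨π, hπ⟩ := (w.under k).exists_ord_eq_one
  refine ⟨w.ord (Units.map (algebraMap k K : k →* K) π),
    w.ord_map_pos (hπ ▸ zero_lt_one), fun x => ?_⟩
  have h := w.ord_map_eq_zero (x := x * π ^ (-(w.under k).ord x)) (by
    rw [ord_mul, ord_zpow, hπ, mul_one, add_neg_cancel])
  rw [map_mul, ord_mul, map_zpow, ord_zpow] at h
  linarith

theorem natCast_ramificationIndexAt_eq (w : FinitePlace K) {e : ℤ} (he : 0 < e)
    (h : ∀ x : kˣ, w.ord (Units.map (algebraMap k K : k →* K) x) = e * (w.under k).ord x) :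
    (ramificationIndexAt k w : ℤ) = e := by
  have hrange : (w.ordHom.comp (Units.map (algebraMap k K : k →* K))).range =
      Subgroup.zpowers (Multiplicative.ofAdd e) := by
    ext n
    rw [Subgroup.mem_zpowers_iff]
    constructor
    · rintro ⟨x, rfl⟩
      refine ⟨(w.under k).ord x, ?_⟩
      rw [← ofAdd_zsmul, smul_eq_mul, mul_comm, ← h]
      rfl
    · rintro ⟨n, rfl⟩
      obtain ⟨π, hπ⟩ := (w.under k).exists_ord_eq_one
      refine ⟨π ^ n, (map_zpow _ π n).trans (congrArg (· ^ n) ?_)⟩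
      exact congrArg Multiplicative.ofAdd ((h π).trans (by rw [hπ, mul_one]))
  rw [ramificationIndexAt, hrange]
  exact (congrArg Nat.cast (Int.index_zmultiples e)).trans (Int.natAbs_of_nonneg he.le)

variable (k) in
theorem ramificationIndexAt_pos (w : FinitePlace K) : 0 < ramificationIndexAt k w := by
  obtain ⟨e, he, h⟩ := w.exists_pos_ord_map_eq_mul k
  rwa [← w.natCast_ramificationIndexAt_eq he h, Nat.cast_pos] at he

theorem ord_map (w : FinitePlace K) (x : kˣ) :
    w.ord (Units.map (algebraMap k K : k →* K) x) =
      ramificationIndexAt k w * (w.under k).ord x := by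
  obtain ⟨e, he, h⟩ := w.exists_pos_ord_map_eq_mul k
  rw [w.natCast_ramificationIndexAt_eq he h, h]

theorem ramificationIndexAt_smul (σ : K ≃ₐ[k] K) (w : FinitePlace K) :
    ramificationIndexAt k (σ • w) = ramificationIndexAt k w := by
  refine Nat.cast_injective (R := ℤ) (natCast_ramificationIndexAt_eq _
    (Nat.cast_pos.2 (w.ramificationIndexAt_pos k)) fun x => ?_)
  have hσ : σ • Units.map (algebraMap k K : k →* K) x = Units.map (algebraMap k K : k →* K) x :=
    Units.ext (σ.commutes x)
  rw [under_smul, ← ord_map w x, ← ord_smul σ w, hσ]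

theorem integralClosure_mem_ring {w : FinitePlace K} {v : FinitePlace k} (h : w.under k = v)
    (b : integralClosure v.ring K) : (b : K) ∈ w.ring := by
  subst h
  exact mem_valuationSubring_of_isIntegral (A := (w.under k).ring) w.ring (fun a => a.2) b.2

end Algebraic

theorem exists_under_eq [FiniteDimensional k K] [Algebra.IsSeparable k K] (v : FinitePlace k) :
    ∃ w : FinitePlace K, w.under k = v := by
  let B := integralClosure v.ring K
  have : IsFractionRing B K := integralClosure.isFractionRing_of_finite_extension k K
  have : IsDedekindDomain B := integralClosure.isDedekindDomain v.ring k K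
  obtain ⟨π, hπ⟩ := v.exists_ord_eq_one
  have hB : ∃ w : FinitePlace K, (∀ b : B, algebraMap B K b ∈ w.ring) ∧
      algebraMap k K (π⁻¹ : kˣ) ∉ w.ring := by
    by_contra! h
    obtain ⟨b, hb⟩ := exists_algebraMap_eq_of_forall_mem_ring B h
    have h_integral : IsIntegral v.ring (algebraMap k K (π⁻¹ : kˣ)) := hb ▸ b.2
    rw [isIntegral_algebraMap_iff (algebraMap k K).injective] at h_integral
    obtain ⟨y, hy⟩ := IsIntegrallyClosed.isIntegral_iff.1 h_integral
    have hmem : ((π⁻¹ : kˣ) : k) ∈ v.ring := hy ▸ y.2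
    rw [v.mem_ring_iff, v.ord_inv, hπ] at hmem
    omega
  obtain ⟨w, hw, -⟩ := hB
  have hle : v.ring ≤ (w.under k).ring := fun a ha => hw (algebraMap v.ring B ⟨a, ha⟩)
  exact ⟨w, FinitePlace.ext
    (ValuationSubring.eq_of_le_of_ne_top _ hle (w.under k).ring_ne_top).symm⟩

variable [FiniteDimensional k K] [IsGalois k K]

theorem exists_smul_eq_of_under_eq {w w' : FinitePlace K} (h : w.under k = w'.under k) :
    ∃ σ : K ≃ₐ[k] K, σ • w = w' := by
  let v := w.under k
  let B := integralClosure v.ring K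
  have : IsFractionRing B K := integralClosure.isFractionRing_of_finite_extension k K
  have : IsDedekindDomain B := integralClosure.isDedekindDomain v.ring k K
  have hprime (u : FinitePlace K) (hu : u.under k = v) :
      ∃ P : HeightOneSpectrum B, placeOfPrime K P = u :=
    exists_placeOfPrime_eq u (integralClosure_mem_ring hu)
  obtain ⟨P, hP⟩ := hprime w rfl
  obtain ⟨P', rfl⟩ := hprime w' h.symm
  obtain ⟨σ, hσ⟩ := exists_galRestrict_mem_iff (k := k) P P'
  obtain ⟨P'', hP''⟩ := hprime (σ • w) (under_smul σ w)
  refine ⟨σ, hP'' ▸ congrArg (placeOfPrime K) (HeightOneSpectrum.ext (Ideal.ext fun b => ?_))⟩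
  obtain ⟨c, rfl⟩ := (galRestrict v.ring k K B σ).surjective b
  rw [hσ, ← mem_nonunits_placeOfPrime_iff (F := K), hP'', algebraMap_galRestrict_apply,
    mem_nonunits_smul, ← hP, mem_nonunits_placeOfPrime_iff]

theorem ramificationIndex_eq (w : FinitePlace K) :
    ramificationIndex K (w.under k) = ramificationIndexAt k w := by
  have h : ∃ w' : FinitePlace K, LiesOver (Sum.inl w') (Sum.inl (w.under k)) :=
    ⟨w, (liesOver_iff _ _).2 rfl⟩
  rw [ramificationIndex, dif_pos h]
  obtain ⟨σ, hσ⟩ := exists_smul_eq_of_under_eq ((liesOver_iff _ _).1 h.choose_spec)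
  rw [← ramificationIndexAt_smul σ, hσ]

theorem ramificationIndex_pos (v : FinitePlace k) : 0 < ramificationIndex K v := by
  obtain ⟨w, rfl⟩ := exists_under_eq (K := K) v
  rw [ramificationIndex_eq]
  exact ramificationIndexAt_pos k w

theorem finite_setOf_under_eq (v : FinitePlace k) : {w : FinitePlace K | w.under k = v}.Finite := by
  obtain ⟨w, rfl⟩ := exists_under_eq (K := K) v
  refine (Set.finite_range fun σ : K ≃ₐ[k] K => σ • w).subset fun w' hw' => ?_
  exact exists_smul_eq_of_under_eq (Eq.symm hw')

end FinitePlace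

theorem placesOver_nonempty [FiniteDimensional k K] [Algebra.IsSeparable k K] {S : Set (Place k)}
    (hS : S.Nonempty) : (placesOver K S).Nonempty := by
  obtain ⟨v | v, hv⟩ := hS
  · obtain ⟨w, rfl⟩ := FinitePlace.exists_under_eq (K := K) v
    exact ⟨Sum.inl w, w.inl_mem_placesOver.2 hv⟩
  · obtain ⟨w, rfl⟩ := InfinitePlace.comap_surjective (K := K) v
    exact ⟨Sum.inr w, _, hv, rfl⟩

theorem placesOver_finite [FiniteDimensional k K] [IsGalois k K] {S : Set (Place k)}
    (hS : S.Finite) [Finite (InfinitePlace K)] : (placesOver K S).Finite := by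
  have h : (⋃ v ∈ {v : FinitePlace k | Sum.inl v ∈ S},
      {w : FinitePlace K | w.under k = v}).Finite :=
    (hS.preimage Sum.inl_injective.injOn).biUnion fun v _ => FinitePlace.finite_setOf_under_eq v
  refine ((h.image Sum.inl).union (Set.finite_range Sum.inr)).subset ?_
  rintro (w | w) hw
  · rw [FinitePlace.inl_mem_placesOver] at hw
    exact Or.inl ⟨w, Set.mem_biUnion hw rfl, rfl⟩
  · exact Or.inr ⟨w, rfl⟩

theorem embedding_of_isReal_algebraMap {w : InfinitePlace K} (hw : w.IsReal)
    (hv : (w.comap (algebraMap k K)).IsReal) (x : k) :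
    InfinitePlace.embedding_of_isReal hw (algebraMap k K x) =
      InfinitePlace.embedding_of_isReal hv x := by
  apply Complex.ofReal_injective
  rw [InfinitePlace.embedding_of_isReal_apply, InfinitePlace.embedding_of_isReal_apply,
    InfinitePlace.comap_embedding_of_isReal _ hv]
  rfl

namespace SModulus

variable {S : Set (Place k)} (m : SModulus S)

section Algebraic

variable [Algebra.IsAlgebraic k K]

omit [Algebra.IsAlgebraic k K] in
theorem mem_of_mem_fin_induced {w : FinitePlace K} (hw : Sum.inl w ∉ placesOver K S)
    {M : Submodule w.ring K} (hM : ∀ b ∈ m.fin, algebraMap k K b ∈ M)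
    {a : sIntegers (placesOver K S)} (ha : a ∈ (m.induced K).fin) : (a : K) ∈ M := by
  change a ∈ Ideal.span _ at ha
  induction ha using Submodule.span_induction with
  | mem a ha =>
    obtain ⟨b, hb, rfl⟩ := ha
    exact hM b hb
  | zero => exact zero_mem M
  | add a b _ _ ha hb => exact add_mem ha hb
  | smul c a _ ha => exact M.smul_mem (⟨c, c.2 w hw⟩ : w.ring) ha

theorem finDvd_induced_iff (w : FinitePlace K) :
    (m.induced K).FinDvd w ↔ m.FinDvd (w.under k) := by
  refine ⟨fun h => ⟨w.inl_mem_placesOver.not.1 h.1, fun a ha => ?_⟩,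
    fun h => ⟨w.inl_mem_placesOver.not.2 h.1, fun a ha => ?_⟩⟩
  · rw [← w.algebraMap_mem_nonunits_iff]
    exact h.2 _ (Ideal.mem_map_of_mem (sIntegersMap K S) ha)
  · have hmax : (a : K) ∈
        Submodule.map (Algebra.linearMap w.ring K) (IsLocalRing.maximalIdeal w.ring) :=
      m.mem_of_mem_fin_induced (w.inl_mem_placesOver.not.2 h.1) (fun b hb => by
        obtain ⟨hb', hmem⟩ := ValuationSubring.mem_nonunits_iff_exists_mem_maximalIdeal.1
          ((w.algebraMap_mem_nonunits_iff (b : k)).2 (h.2 b hb))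
        exact ⟨_, hmem, rfl⟩) ha
    obtain ⟨c, hc, hca⟩ := hmax
    exact hca ▸ ValuationSubring.mem_nonunits_iff_exists_mem_maximalIdeal.2 ⟨c.2, hc⟩

theorem inl_mem_support_induced_iff (w : FinitePlace K) :
    Sum.inl w ∈ (m.induced K).support ↔ Sum.inl (w.under k) ∈ m.support :=
  m.finDvd_induced_iff w

theorem mem_localIdeal_induced_iff {w : FinitePlace K} (hw : Sum.inl w ∉ placesOver K S) (x : k) :
    algebraMap k K x ∈ (m.induced K).localIdeal w ↔ x ∈ m.localIdeal (w.under k) := by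
  obtain ⟨a, ha, ha0, hspan⟩ :=
    m.exists_localIdeal_eq_span_singleton (w.inl_mem_placesOver.not.1 hw)
  have ha0' : algebraMap k K a ≠ 0 := (map_ne_zero _).2 ha0
  have hdvd : ∀ b ∈ m.fin, algebraMap k K b ∈ Submodule.span w.ring {algebraMap k K a} := by
    intro b hb
    have hbk : (b : k) ∈ m.localIdeal (w.under k) := Submodule.subset_span ⟨b, hb, rfl⟩
    rw [hspan, mem_span_singleton_iff_div_mem _ ha0, FinitePlace.mem_under_ring, map_div₀] at hbk
    exact (mem_span_singleton_iff_div_mem _ ha0' _).2 hbk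
  have hspan' : (m.induced K).localIdeal w = Submodule.span w.ring {algebraMap k K a} := by
    refine le_antisymm (Submodule.span_le.2 ?_) ((Submodule.span_singleton_le_iff_mem _ _).2
      (Submodule.subset_span ⟨_, Ideal.mem_map_of_mem (sIntegersMap K S) ha, rfl⟩))
    rintro _ ⟨b, hb, rfl⟩
    exact m.mem_of_mem_fin_induced hw hdvd hb
  rw [hspan', hspan, mem_span_singleton_iff_div_mem _ ha0', mem_span_singleton_iff_div_mem _ ha0,
    FinitePlace.mem_under_ring, map_div₀]

end Algebraic

theorem map_mem_rayGroup_iff [FiniteDimensional k K] [IsGalois k K] (x : kˣ) :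
    Units.map (algebraMap k K : k →* K) x ∈ (m.induced K).rayGroup ↔
      x ∈ (m.unramifiedPart K).rayGroup := by
  have hsub : ((Units.map (algebraMap k K : k →* K) x : Kˣ) : K) - 1 = algebraMap k K (x - 1) := by
    rw [map_sub, map_one]
    rfl
  refine and_congr ⟨fun h v hv => ?_, fun h w hw => ?_⟩ ⟨fun h v hv => ?_, fun h w hw => ?_⟩
  · obtain ⟨w, rfl⟩ := FinitePlace.exists_under_eq (K := K) v
    have hw := (m.finDvd_induced_iff w).2 hv
    exact (m.mem_localIdeal_induced_iff hw.1 _).1 (hsub ▸ h w hw)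
  · rw [hsub, m.mem_localIdeal_induced_iff hw.1]
    exact h _ ((m.finDvd_induced_iff w).1 hw)
  · obtain ⟨w, rfl⟩ := InfinitePlace.comap_surjective (K := K) v
    have hreal : w.IsReal :=
      (InfinitePlace.isUnramified_iff.1 (InfinitePlace.isUnramifiedIn_comap.1 hv.2)).resolve_right
        (InfinitePlace.not_isComplex_iff_isReal.2 (m.isReal _ hv.1))
    rw [← embedding_of_isReal_algebraMap hreal]
    exact h w ⟨hreal, hv.1⟩
  · have hunram := InfinitePlace.isUnramifiedIn_comap (k := k).2
      (InfinitePlace.isUnramified_iff.2 (Or.inl hw.1))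
    change 0 < InfinitePlace.embedding_of_isReal hw.1 (algebraMap k K x)
    rw [embedding_of_isReal_algebraMap hw.1 (m.isReal _ hw.2)]
    exact h _ ⟨hw.2, hunram⟩

end SModulus

end Extension

/-! ### Exact sequences in group cohomology -/

open CategoryTheory groupCohomology

theorem finite_of_fg_of_smul_eq_zero {M : Type*} [AddCommGroup M] [Module ℤ M]
    [Module.Finite ℤ M] {n : ℕ} (hn : n ≠ 0) (h : ∀ x : M, n • x = 0) : Finite M :=
  Module.finite_of_fg_torsion M fun x => ⟨⟨n, mem_nonZeroDivisors_of_ne_zero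
    (Nat.cast_ne_zero.2 hn)⟩, (Nat.cast_smul_eq_nsmul ℤ n x).trans (h x)⟩

theorem card_eq_card_ker_mul_card_range {R M N : Type*} [Ring R] [AddCommGroup M] [AddCommGroup N]
    [Module R M] [Module R N] (f : M →ₗ[R] N) :
    Nat.card M = Nat.card (LinearMap.ker f) * Nat.card (LinearMap.range f) := by
  rw [Submodule.card_eq_card_quotient_mul_card (LinearMap.ker f),
    Nat.card_congr f.quotKerEquivRange.toEquiv, mul_comm]

theorem index_ker_eq_card_range {R M N : Type*} [Ring R] [AddCommGroup M] [AddCommGroup N]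
    [Module R M] [Module R N] (f : M →ₗ[R] N) :
    (LinearMap.ker f).toAddSubgroup.index = Nat.card (LinearMap.range f) :=
  Nat.card_congr f.quotKerEquivRange.toEquiv

theorem index_range_comp {R M N P : Type*} [Ring R] [AddCommGroup M] [AddCommGroup N]
    [AddCommGroup P] [Module R M] [Module R N] [Module R P] (f : M →ₗ[R] N) {g : N →ₗ[R] P}
    (hg : Function.Injective g) :
    (LinearMap.range (g ∘ₗ f)).toAddSubgroup.index =
      (LinearMap.range f).toAddSubgroup.index * (LinearMap.range g).toAddSubgroup.index := by
  rw [LinearMap.range_comp]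
  exact (LinearMap.range f).toAddSubgroup.index_map_of_injective (f := g.toAddMonoidHom) hg

section ExactSequence

variable {R G : Type} [CommRing R] [Group G]

theorem shortExact_of_exact {X : ShortComplex (Rep R G)} (hf : Function.Injective X.f.hom)
    (hg : Function.Surjective X.g.hom) (h : ∀ y, X.g.hom y = 0 → ∃ x, X.f.hom x = y) :
    X.ShortExact where
  exact := by
    rwa [← ShortComplex.exact_map_iff_of_faithful _ (forget₂ (Rep R G) (ModuleCat R)),
      ShortComplex.moduleCat_exact_iff]
  mono_f := (Rep.mono_iff_injective _).2 hf
  epi_g := (Rep.epi_iff_surjective _).2 hg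

theorem exists_of_exact {X : ShortComplex (Rep R G)} (hX : X.Exact) {y : X.X₂}
    (hy : X.g.hom y = 0) : ∃ x, X.f.hom x = y :=
  (ShortComplex.moduleCat_exact_iff _).1 (hX.map (forget₂ (Rep R G) (ModuleCat R))) y hy

/-- The map on `G`-invariants induced by a morphism of representations. -/
abbrev invariantsMap {A B : Rep R G} (f : A ⟶ B) : A.ρ.invariants →ₗ[R] B.ρ.invariants :=
  ((Rep.invariantsFunctor R G).map f).hom

theorem invariantsMap_injective {A B : Rep R G} {f : A ⟶ B} (hf : Function.Injective f.hom) :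
    Function.Injective (invariantsMap f) := fun _ _ h =>
  Subtype.ext (hf (congrArg Subtype.val h))

variable {X : ShortComplex (Rep R G)}

theorem range_invariantsMap_eq_ker (hX : X.ShortExact) :
    LinearMap.range (invariantsMap X.f) = LinearMap.ker (invariantsMap X.g) := by
  have hinj : Function.Injective X.f.hom := (Rep.mono_iff_injective _).1 hX.mono_f
  ext y
  constructor
  · rintro ⟨x, rfl⟩
    exact Subtype.ext (congrArg (fun h : X.X₁ ⟶ X.X₃ => h.hom x.1) X.zero)
  · intro hy
    obtain ⟨x, hx⟩ := exists_of_exact hX.exact (congrArg Subtype.val hy)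
    refine ⟨⟨x, fun s => hinj ?_⟩, Subtype.ext hx⟩
    rw [Rep.hom_comm_apply, hx]
    exact y.2 s

theorem range_H1_map_eq_ker (hX : X.ShortExact) :
    LinearMap.range (map (MonoidHom.id G) X.f 1).hom =
      LinearMap.ker (map (MonoidHom.id G) X.g 1).hom :=
  (mapShortComplex₂_exact hX 1).moduleCat_range_eq_ker

theorem range_H1_map_eq_ker_δ (hX : X.ShortExact) :
    LinearMap.range (map (MonoidHom.id G) X.g 1).hom = LinearMap.ker (δ hX 1 2 rfl).hom :=
  (mapShortComplex₃_exact hX (rfl : 1 + 1 = 2)).moduleCat_range_eq_ker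

theorem range_δ_eq_ker_H2_map (hX : X.ShortExact) :
    LinearMap.range (δ hX 1 2 rfl).hom = LinearMap.ker (map (MonoidHom.id G) X.f 2).hom :=
  (mapShortComplex₁_exact hX (rfl : 1 + 1 = 2)).moduleCat_range_eq_ker

/-- The connecting homomorphism `X₃^G → H¹(G, X₁)`, with `H⁰(G, X₃)` replaced by the invariants. -/
def invariantsConnecting (hX : X.ShortExact) : X.X₃.ρ.invariants →ₗ[R] H1 X.X₁ :=
  (δ hX 0 1 rfl).hom ∘ₗ (H0Iso X.X₃).inv.hom

theorem range_invariantsConnecting (hX : X.ShortExact) :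
    LinearMap.range (invariantsConnecting hX) =
      LinearMap.ker (map (MonoidHom.id G) X.f 1).hom := by
  rw [invariantsConnecting, LinearMap.range_comp_of_range_eq_top _ (LinearMap.range_eq_top.2
    ((ModuleCat.epi_iff_surjective _).1 inferInstance))]
  exact (mapShortComplex₁_exact hX (rfl : 0 + 1 = 1)).moduleCat_range_eq_ker

theorem ker_invariantsConnecting (hX : X.ShortExact) :
    LinearMap.ker (invariantsConnecting hX) = LinearMap.range (invariantsMap X.g) := by
  have hexact : LinearMap.range (map (MonoidHom.id G) X.g 0).hom =
      LinearMap.ker (δ hX 0 1 rfl).hom :=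
    (mapShortComplex₃_exact hX (rfl : 0 + 1 = 1)).moduleCat_range_eq_ker
  have hcomm (z : H0 X.X₂) : (H0Iso X.X₃).hom (map (MonoidHom.id G) X.g 0 z) =
      invariantsMap X.g ((H0Iso X.X₂).hom z) :=
    ConcreteCategory.congr_hom (map_id_comp_H0Iso_hom (A := X.X₂) X.g) z
  ext y
  rw [invariantsConnecting, LinearMap.mem_ker, LinearMap.comp_apply, ← LinearMap.mem_ker, ← hexact]
  constructor
  · rintro ⟨z, hz⟩
    refine ⟨(H0Iso X.X₂).hom z, (hcomm z).symm.trans ?_⟩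
    exact (congrArg (H0Iso X.X₃).hom hz).trans
      (ConcreteCategory.congr_hom (H0Iso X.X₃).inv_hom_id y)
  · rintro ⟨x, rfl⟩
    refine ⟨(H0Iso X.X₂).inv x, ?_⟩
    have h := hcomm ((H0Iso X.X₂).inv x)
    rw [Iso.inv_hom_id_apply] at h
    exact (Iso.hom_inv_id_apply _ _).symm.trans (congrArg (H0Iso X.X₃).inv h)

variable {A B P I C : Rep R G} {f : A ⟶ B} {g : B ⟶ P} {i : P ⟶ I} {q : I ⟶ C}
  {hfg : f ≫ g = 0} {hiq : i ≫ q = 0}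

theorem index_range_invariantsMap_comp (hX : (ShortComplex.mk f g hfg).ShortExact)
    (hY : (ShortComplex.mk i q hiq).ShortExact) :
    (LinearMap.range (invariantsMap (g ≫ i))).toAddSubgroup.index =
      Nat.card (LinearMap.ker (map (MonoidHom.id G) f 1).hom) *
        Nat.card (LinearMap.range (invariantsMap q)) := by
  have hi : Function.Injective (invariantsMap i) :=
    invariantsMap_injective ((Rep.mono_iff_injective _).1 hY.mono_f)
  have hcomp : invariantsMap (g ≫ i) = invariantsMap i ∘ₗ invariantsMap g := rfl
  rw [hcomp, index_range_comp _ hi, range_invariantsMap_eq_ker hY,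
    ← ker_invariantsConnecting hX, index_ker_eq_card_range, index_ker_eq_card_range,
    range_invariantsConnecting]

theorem card_invariants_eq_of_subsingleton_H1 [Subsingleton (H1 I)]
    (hY : (ShortComplex.mk i q hiq).ShortExact) :
    Nat.card C.ρ.invariants = Nat.card (LinearMap.range (invariantsMap q)) * Nat.card (H1 P) := by
  have hker : LinearMap.ker (map (MonoidHom.id G) i 1).hom = ⊤ :=
    eq_top_iff.2 fun x _ => Subsingleton.elim (α := H1 I) _ _
  rw [card_eq_card_ker_mul_card_range (invariantsConnecting hY), ker_invariantsConnecting,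
    range_invariantsConnecting, hker]
  exact congrArg _ (Nat.card_congr (Submodule.topEquiv (R := R) (M := H1 P)).toEquiv)

theorem card_invariants_mul_eq [Subsingleton (H1 I)]
    (hX : (ShortComplex.mk f g hfg).ShortExact) (hY : (ShortComplex.mk i q hiq).ShortExact) :
    Nat.card C.ρ.invariants * Nat.card (H1 A) *
        Nat.card (LinearMap.range (map (MonoidHom.id G) f 2).hom) =
      (LinearMap.range (invariantsMap (g ≫ i))).toAddSubgroup.index *
        Nat.card (H2 A) * Nat.card (H1 B) := by
  rw [index_range_invariantsMap_comp hX hY, card_invariants_eq_of_subsingleton_H1 hY,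
    card_eq_card_ker_mul_card_range (δ hX 1 2 rfl).hom, ← range_H1_map_eq_ker_δ hX,
    range_δ_eq_ker_H2_map hX,
    card_eq_card_ker_mul_card_range (map (MonoidHom.id G) f 1).hom,
    card_eq_card_ker_mul_card_range (map (MonoidHom.id G) f 2).hom,
    card_eq_card_ker_mul_card_range (map (MonoidHom.id G) g 1).hom, ← range_H1_map_eq_ker hX]
  ring

end ExactSequence

section Finiteness

variable {R G : Type} [CommRing R] [Group G]

theorem card_smul_H1_eq_zero [Fintype G] (A : Rep R G) (x : H1 A) :
    Fintype.card G • x = 0 := by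
  induction x using H1_induction_on with
  | h f =>
    rw [← map_nsmul (H1π A).hom]
    -- The cocycle `|G| f` is the coboundary of `-∑ h, f h`.
    refine (H1π_eq_zero_iff _).2 ⟨-∑ h, f h, funext fun g => ?_⟩
    have hf := (mem_cocycles₁_iff (f : G → A)).1 f.2
    have hsum : ∑ h, f h = A.ρ g (∑ h, f h) + Fintype.card G • f g := calc
      ∑ h, f h = ∑ h, f (g * h) := (Equiv.sum_comp (Equiv.mulLeft g) (fun h => f h)).symm
      _ = ∑ h, (A.ρ g (f h) + f g) := Finset.sum_congr rfl fun h _ => hf g h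
      _ = _ := by rw [Finset.sum_add_distrib, map_sum, Finset.sum_const, Finset.card_univ]
    change A.ρ g (-∑ h, f h) - (-∑ h, f h) = Fintype.card G • f g
    rw [map_neg, sub_neg_eq_add, neg_add_eq_sub, sub_eq_iff_eq_add']
    exact hsum

theorem card_smul_H2_eq_zero [Fintype G] (A : Rep R G) (x : H2 A) :
    Fintype.card G • x = 0 := by
  induction x using H2_induction_on with
  | h f =>
    rw [← map_nsmul (H2π A).hom]
    -- The cocycle `|G| f` is the coboundary of `g ↦ ∑ j, f (g, j)`.
    refine (H2π_eq_zero_iff _).2 ⟨fun g => ∑ j, f (g, j), funext fun ⟨g, h⟩ => ?_⟩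
    have hf := (mem_cocycles₂_iff (f : G × G → A)).1 f.2
    have hsum : ∑ j, f (g * h, j) + Fintype.card G • f (g, h) =
        A.ρ g (∑ j, f (h, j)) + ∑ j, f (g, j) := calc
      _ = ∑ j, (f (g * h, j) + f (g, h)) := by
        rw [Finset.sum_add_distrib, Finset.sum_const, Finset.card_univ]
      _ = ∑ j, (A.ρ g (f (h, j)) + f (g, h * j)) := Finset.sum_congr rfl fun j _ => hf g h j
      _ = A.ρ g (∑ j, f (h, j)) + ∑ j, f (g, h * j) := by rw [Finset.sum_add_distrib, map_sum]
      _ = _ := congrArg _ (Equiv.sum_comp (Equiv.mulLeft h) fun j => f (g, j))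
    change A.ρ g (∑ j, f (h, j)) - ∑ j, f (g * h, j) + ∑ j, f (g, j) = Fintype.card G • f (g, h)
    rw [sub_add_eq_add_sub, ← hsum, add_sub_cancel_left]

variable [IsNoetherianRing R]

theorem module_finite_H1 [Finite G] (A : Rep R G) [Module.Finite R A] : Module.Finite R (H1 A) := by
  have : Module.Finite R (cocycles₁ A) := inferInstance
  exact .of_surjective (H1π A).hom ((ModuleCat.epi_iff_surjective _).1 inferInstance)

theorem module_finite_H2 [Finite G] (A : Rep R G) [Module.Finite R A] : Module.Finite R (H2 A) := by
  have : Module.Finite R (cocycles₂ A) := inferInstance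
  exact .of_surjective (H2π A).hom ((ModuleCat.epi_iff_surjective _).1 inferInstance)

theorem module_finite_H1_of_finite_cokernel {A B : Rep R G} (f : A ⟶ B) [Mono f]
    [Subsingleton (H1 B)] (h : Module.Finite R (B ⧸ LinearMap.range f.hom.toLinearMap)) :
    Module.Finite R (H1 A) := by
  let C := Limits.cokernel f
  let π : B ⟶ C := Limits.cokernel.π f
  have hX : (ShortComplex.mk f π (Limits.cokernel.condition f)).ShortExact :=
    { exact := ShortComplex.exact_cokernel f }
  have hπ : Function.Surjective π.hom := (Rep.epi_iff_surjective _).1 inferInstance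
  have hle : LinearMap.range f.hom.toLinearMap ≤ LinearMap.ker π.hom.toLinearMap := by
    rintro _ ⟨x, rfl⟩
    exact congrArg (fun h : A ⟶ C => h.hom x) (Limits.cokernel.condition f)
  have : Module.Finite R C := .of_surjective (Submodule.liftQ _ π.hom.toLinearMap hle)
    (LinearMap.range_eq_top.1 ((Submodule.range_liftQ _ _ hle).trans (LinearMap.range_eq_top.2 hπ)))
  have hδ : LinearMap.range (invariantsConnecting hX) = ⊤ := by
    rw [range_invariantsConnecting, eq_top_iff]
    exact fun x _ => Subsingleton.elim (α := H1 B) _ _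
  have : Module.Finite R C.ρ.invariants := inferInstance
  exact .of_surjective _ (LinearMap.range_eq_top.1 hδ)

end Finiteness

theorem finite_H1_of_module_finite {G : Type} [Group G] [Finite G] {A : Rep ℤ G}
    (h : Module.Finite ℤ (H1 A)) : Finite (H1 A) := by
  have := Fintype.ofFinite G
  exact finite_of_fg_of_smul_eq_zero Fintype.card_ne_zero (card_smul_H1_eq_zero A)

theorem finite_H2_of_module_finite {G : Type} [Group G] [Finite G] {A : Rep ℤ G}
    (h : Module.Finite ℤ (H2 A)) : Finite (H2 A) := by
  have := Fintype.ofFinite G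
  exact finite_of_fg_of_smul_eq_zero Fintype.card_ne_zero (card_smul_H2_eq_zero A)

/-! ### The Galois modules of divisors and rays -/

namespace SModulus

section DivisorMap

variable {F : Type*} [Field F] {S : Set (Place F)} (m : SModulus S)

theorem mem_unitGroup_iff {x : Fˣ} : x ∈ m.unitGroup ↔
    x ∈ m.rayGroup ∧ ∀ w : FinitePlace F, Sum.inl w ∉ S → w.ord x = 0 := by
  rw [and_comm]
  exact and_congr_left fun _ => ⟨ord_eq_zero_of_mem_sUnits, fun h =>
    ⟨fun w hw => (w.mem_ring_iff x).2 (h w hw).ge,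
      fun w hw => (w.mem_ring_iff x⁻¹).2 (by rw [w.ord_inv, h w hw, neg_zero])⟩⟩

variable (hF : IsGlobalField F)

open Classical in
/-- The divisor `∑_{w ∉ S} ord_w(x) w` of an element `x` of `F^𝔪`, as a principal divisor. -/
def divHom : Additive m.rayGroup →+ m.principalDivisors where
  toFun x := ⟨⟨Finsupp.ofSupportFinite
      (fun w => if Sum.inl w ∈ S then 0 else w.ord x.toMul.1)
      ((hF.finite_setOf_ord_ne_zero x.toMul.1).subset fun w hw => (ite_ne_left_iff.1 hw).2.symm),
      fun w hw => by
        change (if Sum.inl w ∈ S then 0 else w.ord x.toMul.1) = 0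
        split_ifs with h
        · rfl
        · exact m.rayGroup_le_localUnits x.toMul.2 w (hw.resolve_left h)⟩,
    x.toMul.1, x.toMul.2, fun w hw => if_neg hw⟩
  map_zero' := Subtype.ext (Subtype.ext (Finsupp.ext fun w =>
    (congrArg (ite _ 0) w.ord_one).trans (ite_self 0)))
  map_add' x y := Subtype.ext (Subtype.ext (Finsupp.ext fun w => by
    change (if Sum.inl w ∈ S then 0 else w.ord (x.toMul.1 * y.toMul.1)) =
      (if Sum.inl w ∈ S then 0 else w.ord x.toMul.1) +
        (if Sum.inl w ∈ S then 0 else w.ord y.toMul.1)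
    split_ifs
    · rfl
    · exact w.ord_mul _ _))

theorem divHom_apply_of_notMem (x : Additive m.rayGroup) {w : FinitePlace F}
    (hw : Sum.inl w ∉ S) : (m.divHom hF x).1.1 w = w.ord x.toMul.1 := if_neg hw

theorem divHom_eq_iff (x : Additive m.rayGroup) (D : m.principalDivisors) :
    m.divHom hF x = D ↔ ∀ w : FinitePlace F, Sum.inl w ∉ S → D.1.1 w = w.ord x.toMul.1 := by
  constructor
  · rintro rfl w hw
    exact m.divHom_apply_of_notMem hF x hw
  · intro h
    refine Subtype.ext (Subtype.ext (Finsupp.ext fun w => ?_))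
    by_cases hw : Sum.inl w ∈ S
    · rw [(m.divHom hF x).1.2 w (Or.inl hw), D.1.2 w (Or.inl hw)]
    · rw [m.divHom_apply_of_notMem hF x hw, h w hw]

theorem divHom_surjective : Function.Surjective (m.divHom hF) := by
  rintro ⟨D, x, hx, h⟩
  exact ⟨Additive.ofMul ⟨x, hx⟩, (m.divHom_eq_iff hF _ _).2 h⟩

theorem divHom_eq_zero_iff (x : Additive m.rayGroup) :
    m.divHom hF x = 0 ↔ x.toMul.1 ∈ m.unitGroup := by
  rw [divHom_eq_iff, mem_unitGroup_iff]
  exact ⟨fun h => ⟨x.toMul.2, fun w hw => (h w hw).symm⟩, fun h w hw => (h.2 w hw).symm⟩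

end DivisorMap

section GaloisModules

variable {k K : Type} [Field k] [Field K] [Algebra k K] {S : Set (Place k)} (m : SModulus S)

theorem smul_divisor_apply (σ : K ≃ₐ[k] K) (D : (m.induced K).divisorGroup) (w : FinitePlace K) :
    (σ • D).1 w = D.1 (σ⁻¹ • w) := by
  have h : (σ • D).1 (σ • (σ⁻¹ • w)) = D.1 (σ⁻¹ • w) :=
    Finsupp.mapDomain_apply (MulAction.injective σ) D.1 (σ⁻¹ • w)
  rwa [smul_inv_smul] at h

instance principalDivisorsAction :
    DistribMulAction (K ≃ₐ[k] K) (m.induced K).principalDivisors where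
  smul σ D := ⟨σ • D.1, m.smul_mem_principalDivisors σ D.2⟩
  one_smul D := Subtype.ext (one_smul _ D.1)
  mul_smul σ τ D := Subtype.ext (mul_smul σ τ D.1)
  smul_zero σ := Subtype.ext (smul_zero σ)
  smul_add σ D E := Subtype.ext (smul_add σ D.1 E.1)

theorem divHom_smul (hK : IsGlobalField K) (σ : K ≃ₐ[k] K) (x : (m.induced K).rayGroup) :
    (m.induced K).divHom hK (Additive.ofMul (σ • x)) =
      σ • (m.induced K).divHom hK (Additive.ofMul x) := by
  rw [divHom_eq_iff]
  intro w hw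
  refine (m.smul_divisor_apply σ _ w).trans ?_
  rw [divHom_apply_of_notMem _ _ _ (by rwa [smul_mem_placesOver])]
  exact (ord_smul σ (σ⁻¹ • w) x.1).symm.trans (by rw [smul_inv_smul]; rfl)

variable (K)

/-- The `Gal(K/k)`-module `I_K^{S(𝔪) ∪ S}`. -/
abbrev divisorRep : Rep ℤ (K ≃ₐ[k] K) :=
  Rep.ofDistribMulAction ℤ (K ≃ₐ[k] K) (m.induced K).divisorGroup

/-- The `Gal(K/k)`-module `Cl^𝔪_{K,S}`. -/
abbrev classRep : Rep ℤ (K ≃ₐ[k] K) :=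
  Rep.ofDistribMulAction ℤ (K ≃ₐ[k] K) (m.induced K).ClassGroup

/-- The `Gal(K/k)`-module of principal divisors. -/
abbrev principalRep : Rep ℤ (K ≃ₐ[k] K) :=
  Rep.ofDistribMulAction ℤ (K ≃ₐ[k] K) (m.induced K).principalDivisors

/-- The inclusion `K^𝔪 → Kˣ` of `Gal(K/k)`-modules. -/
def rayInclusion : m.rayRep K ⟶ Rep.ofAlgebraAutOnUnits k K :=
  Rep.ofHom
    { toLinearMap := (MonoidHom.toAdditive (m.induced K).rayGroup.subtype).toIntLinearMap
      isIntertwining' := fun _ => rfl }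

/-- The inclusion of the principal divisors in `I_K^{S(𝔪) ∪ S}`, as a map of
`Gal(K/k)`-modules. -/
def principalInclusion : m.principalRep K ⟶ m.divisorRep K :=
  Rep.ofHom
    { toLinearMap := (m.induced K).principalDivisors.subtype.toIntLinearMap
      isIntertwining' := fun _ => rfl }

/-- The projection `I_K^{S(𝔪) ∪ S} → Cl^𝔪_{K,S}` of `Gal(K/k)`-modules. -/
def classProjection : m.divisorRep K ⟶ m.classRep K :=
  Rep.ofHom
    { toLinearMap := (QuotientAddGroup.mk' (m.induced K).principalDivisors).toIntLinearMap
      isIntertwining' := fun _ => rfl }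

theorem principalInclusion_comp_classProjection :
    m.principalInclusion K ≫ m.classProjection K = 0 := by
  ext x
  exact (QuotientAddGroup.eq_zero_iff _).2 x.2

theorem classSequence_shortExact :
    (ShortComplex.mk _ _ (m.principalInclusion_comp_classProjection K)).ShortExact :=
  shortExact_of_exact Subtype.val_injective QuotientAddGroup.mk_surjective fun y hy =>
    ⟨⟨y, (QuotientAddGroup.eq_zero_iff _).1 hy⟩, rfl⟩

variable {K} (hK : IsGlobalField K)

/-- The divisor map from `K^𝔪` to the principal divisors, as a map of `Gal(K/k)`-modules. -/
def divRepHom : m.rayRep K ⟶ m.principalRep K :=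
  Rep.ofHom
    { toLinearMap := ((m.induced K).divHom hK).toIntLinearMap
      isIntertwining' := fun σ => LinearMap.ext fun x => m.divHom_smul hK σ (Additive.toMul x) }

theorem unitInclusion_comp_divRepHom : m.unitInclusion K ≫ m.divRepHom hK = 0 := by
  ext x
  exact ((m.induced K).divHom_eq_zero_iff hK _).2 (Additive.toMul x).2

theorem unitSequence_shortExact :
    (ShortComplex.mk _ _ (m.unitInclusion_comp_divRepHom hK)).ShortExact := by
  refine shortExact_of_exact ?_ ((m.induced K).divHom_surjective hK) fun y hy => ?_
  · exact fun x y h => Subtype.ext (congrArg (fun z : (m.induced K).rayGroup => z.1) h)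
  · exact ⟨show Additive (m.induced K).unitGroup from
      Additive.ofMul ⟨_, ((m.induced K).divHom_eq_zero_iff hK y).1 hy⟩, rfl⟩

variable [FiniteDimensional k K]

theorem subsingleton_H1_divisorRep : Subsingleton (H1 (m.divisorRep K)) := by
  have := Fintype.ofFinite (K ≃ₐ[k] K)
  let n := Fintype.card (K ≃ₐ[k] K)
  have hn : (n : ℤ) ≠ 0 := Nat.cast_ne_zero.2 Fintype.card_ne_zero
  refine subsingleton_of_forall_eq 0 fun x => ?_
  induction x using H1_induction_on with
  | h f =>
    have h := card_smul_H1_eq_zero _ (H1π (m.divisorRep K) f)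
    rw [← map_nsmul (H1π (m.divisorRep K)).hom] at h
    obtain ⟨D, hD⟩ := (H1π_eq_zero_iff _).1 h
    let D₁ : (m.induced K).divisorGroup := D
    have hD₁ (σ : K ≃ₐ[k] K) (w : FinitePlace K) :
        D₁.1 (σ⁻¹ • w) = D₁.1 w + n * (f σ : (m.induced K).divisorGroup).1 w := by
      have hw : (σ • D₁).1 w - D₁.1 w = n • (f σ : (m.induced K).divisorGroup).1 w :=
        congrArg (fun E : (m.induced K).divisorGroup => E.1 w) (congrFun hD σ)
      rw [smul_divisor_apply, nsmul_eq_mul] at hw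
      exact sub_eq_iff_eq_add'.1 hw
    -- As `σ D - D = n f(σ)`, dividing the coefficients of `D` by `n` and rounding down
    -- still commutes with the action up to `f(σ)`.
    let E : (m.induced K).divisorGroup :=
      ⟨D₁.1.mapRange (· / (n : ℤ)) (Int.zero_ediv _), fun w hw => by
        rw [Finsupp.mapRange_apply, D₁.2 w hw, Int.zero_ediv]⟩
    refine (H1π_eq_zero_iff _).2 ⟨E, funext fun σ => Subtype.ext (Finsupp.ext fun w => ?_)⟩
    refine (congrArg (· - D₁.1 w / (n : ℤ)) (m.smul_divisor_apply σ E w)).trans ?_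
    change D₁.1 (σ⁻¹ • w) / (n : ℤ) - D₁.1 w / (n : ℤ) = _
    rw [hD₁, Int.add_mul_ediv_left _ _ hn, add_sub_cancel_left]

include hK

theorem finite_H1_rayRep (hS : (placesOver K S).Nonempty) : Finite (H1 (m.rayRep K)) := by
  have : Mono (m.rayInclusion K) := (Rep.mono_iff_injective _).2 Subtype.val_injective
  have hrange : LinearMap.range (m.rayInclusion K).hom.toLinearMap =
      (Subgroup.toAddSubgroup (m.induced K).rayGroup).toIntSubmodule :=
    Submodule.ext fun x =>
      ⟨fun ⟨y, hy⟩ => hy ▸ (Additive.toMul y).2, fun hx => ⟨Additive.ofMul ⟨x, hx⟩, rfl⟩⟩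
  refine finite_H1_of_module_finite (module_finite_H1_of_finite_cokernel (m.rayInclusion K) ?_)
  rw [hrange]
  exact (m.induced K).finite_quotient_rayGroup hK hS

theorem finite_H1_unitRep (hS : (placesOver K S).Finite) : Finite (H1 (m.unitRep K)) :=
  have : @Module.Finite ℤ (m.unitRep K) _ _ (m.unitRep K).hV2 :=
    (m.induced K).finite_unitGroup hK hS
  finite_H1_of_module_finite (module_finite_H1 (m.unitRep K))

theorem finite_H2_unitRep (hS : (placesOver K S).Finite) : Finite (H2 (m.unitRep K)) :=
  have : @Module.Finite ℤ (m.unitRep K) _ _ (m.unitRep K).hV2 :=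
    (m.induced K).finite_unitGroup hK hS
  finite_H2_of_module_finite (module_finite_H2 (m.unitRep K))

end GaloisModules

end SModulus

/-! ### Invariant divisors -/

section FinsuppIndex

variable {U : Type*} (a : U → ℕ)

/-- The subgroup of the finitely supported functions `n : U → ℤ` with `a u ∣ n u` for all `u`. -/
def dvdSubgroup : AddSubgroup (U →₀ ℤ) where
  carrier := {n | ∀ u, (a u : ℤ) ∣ n u}
  add_mem' h h' u := dvd_add (h u) (h' u)
  zero_mem' _ := dvd_zero _
  neg_mem' h u := (dvd_neg (α := ℤ)).2 (h u)

theorem exists_eq_mul_of_mem_dvdSubgroup {n : U →₀ ℤ} (hn : n ∈ dvdSubgroup a) :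
    ∃ q : U →₀ ℤ, ∀ u, n u = a u * q u := by
  choose q hq using hn
  refine ⟨Finsupp.onFinset n.support (fun u => if n u = 0 then 0 else q u) fun u hu => ?_,
    fun u => ?_⟩
  · exact Finsupp.mem_support_iff.2 fun h => hu (if_pos h)
  · rw [Finsupp.onFinset_apply]
    split_ifs with h
    · rw [h, mul_zero]
    · exact hq u

theorem finite_setOf_ne_one_of_index_dvdSubgroup (h : (dvdSubgroup a).index ≠ 0) :
    {u | a u ≠ 1}.Finite := by
  classical
  have : (dvdSubgroup a).FiniteIndex := ⟨h⟩
  have : Finite ((U →₀ ℤ) ⧸ dvdSubgroup a) := inferInstance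
  have hinj : Function.Injective (fun u : {u | a u ≠ 1} =>
      ((Finsupp.single u.1 (1 : ℤ) : U →₀ ℤ) : (U →₀ ℤ) ⧸ dvdSubgroup a)) := by
    intro u v huv
    by_contra hne
    have hmem := QuotientAddGroup.eq.1 huv v.1
    rw [Finsupp.add_apply, Finsupp.neg_apply, Finsupp.single_eq_same,
      Finsupp.single_eq_of_ne (fun h => hne (Subtype.ext h.symm)), neg_zero, zero_add] at hmem
    exact v.2 (by exact_mod_cast Int.eq_one_of_dvd_one (by positivity) hmem)
  exact Set.finite_coe_iff.1 (Finite.of_injective _ hinj)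

theorem index_dvdSubgroup (h : {u | a u ≠ 1}.Finite) :
    (dvdSubgroup a).index = ∏ᶠ u, a u := by
  have := h.fintype
  let φ : (U →₀ ℤ) →+ ∀ u : {u | a u ≠ 1}, ZMod (a u) :=
    AddMonoidHom.mk' (fun n u => (n u.1 : ZMod (a u))) fun n n' => funext fun u => by
      simp only [Finsupp.add_apply, Int.cast_add, Pi.add_apply]
  have hker : φ.ker = dvdSubgroup a := by
    ext n
    refine ⟨fun hn u => ?_, fun hn => funext fun u =>
      (ZMod.intCast_zmod_eq_zero_iff_dvd _ _).2 (hn u.1)⟩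
    by_cases hu : a u = 1
    · exact hu ▸ one_dvd _
    · exact (ZMod.intCast_zmod_eq_zero_iff_dvd _ _).1 (congrFun hn ⟨u, hu⟩)
  have hsurj : Function.Surjective φ := by
    intro c
    choose n hn using fun u => ZMod.intCast_surjective (c u)
    refine ⟨(Finsupp.equivFunOnFinite.symm n).embDomain (.subtype _), funext fun u => ?_⟩
    rw [← hn u]
    exact congrArg _ (Finsupp.embDomain_apply_self _ _ u)
  rw [← hker, AddSubgroup.index_ker, AddMonoidHom.range_eq_top.2 hsurj,
    Nat.card_congr AddSubgroup.topEquiv.toEquiv, Nat.card_pi]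
  simp only [Nat.card_zmod]
  rw [finprod_eq_prod_of_mulSupport_subset (s := h.toFinset) a fun u hu => h.mem_toFinset.2 hu]
  exact (Finset.prod_subtype h.toFinset (fun u => h.mem_toFinset) a).symm

end FinsuppIndex

namespace SModulus

variable {k K : Type} [Field k] [Field K] [Algebra k K] {S : Set (Place k)} (m : SModulus S)

theorem inl_mem_union_support_induced_iff [Algebra.IsAlgebraic k K] (w : FinitePlace K) :
    Sum.inl w ∈ placesOver K S ∪ (m.induced K).support ↔ Sum.inl (w.under k) ∈ S ∪ m.support :=
  or_congr w.inl_mem_placesOver (m.inl_mem_support_induced_iff w)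

/-- The coefficient of an invariant divisor at a place. -/
def coeff (D : (m.divisorRep K).ρ.invariants) (w : FinitePlace K) : ℤ :=
  (D.1 : (m.induced K).divisorGroup).1 w

variable {m} in
theorem invariants_ext {D D' : (m.divisorRep K).ρ.invariants}
    (h : ∀ w, m.coeff D w = m.coeff D' w) : D = D' :=
  Subtype.ext (Subtype.ext (Finsupp.ext h))

theorem coeff_eq_zero [Algebra.IsAlgebraic k K] (D : (m.divisorRep K).ρ.invariants)
    {w : FinitePlace K} (hw : Sum.inl (w.under k) ∈ S ∪ m.support) : m.coeff D w = 0 :=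
  (D.1 : (m.induced K).divisorGroup).2 w ((m.inl_mem_union_support_induced_iff w).2 hw)

variable (K) in
theorem exists_divisor_apply_eq (q : {v : FinitePlace k // Sum.inl v ∉ S ∪ m.support} →₀ ℤ) :
    ∃ n : (m.unramifiedPart K).divisorGroup, ∀ v, n.1 v.1 = q v := by
  classical
  refine ⟨⟨q.embDomain (.subtype _), fun v hv => ?_⟩, Finsupp.embDomain_apply_self _ _⟩
  refine Finsupp.embDomain_of_notMem_range _ _ _ ?_
  rintro ⟨u, rfl⟩
  exact u.2 hv

variable [FiniteDimensional k K] [IsGalois k K]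

theorem coeff_eq_of_under_eq (D : (m.divisorRep K).ρ.invariants) {w w' : FinitePlace K}
    (h : w.under k = w'.under k) : m.coeff D w = m.coeff D w' := by
  obtain ⟨σ, rfl⟩ := FinitePlace.exists_smul_eq_of_under_eq h
  let D₁ : (m.induced K).divisorGroup := D.1
  have hσ : σ • D₁ = D₁ := D.2 σ
  have h₁ := m.smul_divisor_apply σ D₁ (σ • w)
  rw [inv_smul_smul, hσ] at h₁
  exact h₁.symm

variable (K)

/-- The invariant divisor `∑_w a(v) n(v) w` of `K`, where `v` is the place of `k` under `w`. For
`a(v) = e_v` this is the extension of the divisor `n` to `K`. -/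
def pullback (a : FinitePlace k → ℤ) :
    (m.unramifiedPart K).divisorGroup →+ (m.divisorRep K).ρ.invariants where
  toFun n := ⟨(⟨Finsupp.ofSupportFinite (fun w => a (w.under k) * n.1 (w.under k))
      ((n.1.hasFiniteSupport.biUnion fun v _ =>
        FinitePlace.finite_setOf_under_eq (K := K) v).subset fun w hw =>
          Set.mem_biUnion (x := w.under k) (right_ne_zero_of_mul hw) rfl),
      fun w hw => (mul_eq_zero_of_right _
        (n.2 _ ((m.inl_mem_union_support_induced_iff w).1 hw)))⟩ : (m.induced K).divisorGroup),
    fun σ => Subtype.ext (Finsupp.ext fun w => by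
      refine (m.smul_divisor_apply σ _ w).trans ?_
      change a ((σ⁻¹ • w).under k) * n.1 ((σ⁻¹ • w).under k) = a (w.under k) * n.1 (w.under k)
      rw [FinitePlace.under_smul])⟩
  map_zero' := invariants_ext fun _ => mul_zero _
  map_add' _ _ := invariants_ext fun _ => mul_add _ _ _

variable {K}

theorem coeff_pullback (a : FinitePlace k → ℤ) (n : (m.unramifiedPart K).divisorGroup)
    (w : FinitePlace K) :
    m.coeff (m.pullback K a n) w = a (w.under k) * n.1 (w.under k) := rfl

theorem pullback_injective :
    Function.Injective (m.pullback K fun v => ramificationIndex K v) := by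
  intro n n' h
  refine Subtype.ext (Finsupp.ext fun v => ?_)
  obtain ⟨w, rfl⟩ := FinitePlace.exists_under_eq (K := K) v
  have hw := congrArg (m.coeff · w) h
  simp only [coeff_pullback] at hw
  exact mul_left_cancel₀ (Nat.cast_ne_zero.2 (FinitePlace.ramificationIndex_pos _).ne') hw

variable (K)

/-- The ramification indices of the places outside `S ∪ S(𝔪)`. -/
def ramificationFamily (v : {v : FinitePlace k // Sum.inl v ∉ S ∪ m.support}) : ℕ :=
  ramificationIndex K v.1

/-- The coefficients of an invariant divisor, indexed by the places of `k` outside `S ∪ S(𝔪)`: the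
coefficient at `v` is the common one at the places over `v`, read off at a chosen one. -/
def descend : (m.divisorRep K).ρ.invariants →+
    ({v : FinitePlace k // Sum.inl v ∉ S ∪ m.support} →₀ ℤ) :=
  AddMonoidHom.mk' (fun D => (D.1 : (m.induced K).divisorGroup).1.comapDomain
    (fun v => Function.surjInv FinitePlace.exists_under_eq v.1)
    ((Function.injective_surjInv _).comp Subtype.val_injective).injOn)
    fun _ _ => Finsupp.ext fun _ => rfl

variable {K}

theorem descend_under (D : (m.divisorRep K).ρ.invariants) {w : FinitePlace K}
    (hw : Sum.inl (w.under k) ∉ S ∪ m.support) :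
    m.descend K D ⟨w.under k, hw⟩ = m.coeff D w :=
  m.coeff_eq_of_under_eq D (Function.surjInv_eq _ _)

theorem descend_pullback (a : FinitePlace k → ℤ) (n : (m.unramifiedPart K).divisorGroup)
    (v : {v : FinitePlace k // Sum.inl v ∉ S ∪ m.support}) :
    m.descend K (m.pullback K a n) v = a v * n.1 v := by
  obtain ⟨v, hv⟩ := v
  obtain ⟨w, rfl⟩ := FinitePlace.exists_under_eq (K := K) v
  rw [descend_under, coeff_pullback]

theorem descend_injective : Function.Injective (m.descend K) := by
  intro D D' h
  refine invariants_ext fun w => ?_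
  by_cases hw : Sum.inl (w.under k) ∈ S ∪ m.support
  · rw [m.coeff_eq_zero D hw, m.coeff_eq_zero D' hw]
  · rw [← m.descend_under D hw, h, descend_under]

variable (K)

theorem descend_surjective : Function.Surjective (m.descend K) := by
  intro q
  obtain ⟨n, hn⟩ := m.exists_divisor_apply_eq K q
  exact ⟨m.pullback K (fun _ => 1) n, Finsupp.ext fun v => by
    rw [descend_pullback, one_mul, hn]⟩

theorem range_pullback_eq_comap :
    (m.pullback K fun v => ramificationIndex K v).range =
      (dvdSubgroup (m.ramificationFamily K)).comap (m.descend K) := by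
  ext D
  constructor
  · rintro ⟨n, rfl⟩ v
    exact ⟨n.1 v, m.descend_pullback _ n v⟩
  · intro hD
    obtain ⟨q, hq⟩ := exists_eq_mul_of_mem_dvdSubgroup _ hD
    obtain ⟨n, hn⟩ := m.exists_divisor_apply_eq K q
    exact ⟨n, m.descend_injective (Finsupp.ext fun v => by
      rw [descend_pullback, hn, hq, ramificationFamily])⟩

theorem index_range_pullback :
    (m.pullback K fun v => ramificationIndex K v).range.index =
      (dvdSubgroup (m.ramificationFamily K)).index := by
  rw [range_pullback_eq_comap,
    AddSubgroup.index_comap_of_surjective _ (m.descend_surjective K)]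

/-- The inclusion `k^{𝔪_r} → (K^𝔪)^G`. -/
def rayToInvariants : Additive (m.unramifiedPart K).rayGroup →+ (m.rayRep K).ρ.invariants where
  toFun x := ⟨show Additive (m.induced K).rayGroup from
      Additive.ofMul ⟨_, (m.map_mem_rayGroup_iff x.toMul.1).2 x.toMul.2⟩,
    fun σ => Additive.toMul.injective (Subtype.ext (Units.ext (σ.commutes _)))⟩
  map_zero' := Subtype.ext (Additive.toMul.injective (Subtype.ext (map_one _)))
  map_add' x y := Subtype.ext (Additive.toMul.injective
    (Subtype.ext (map_mul _ x.toMul.1 y.toMul.1)))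

variable {K} in
theorem exists_units_map_eq {x : Kˣ} (h : ∀ σ : K ≃ₐ[k] K, σ • x = x) :
    ∃ y : kˣ, Units.map (algebraMap k K : k →* K) y = x := by
  obtain ⟨y, hy⟩ := (IsGalois.mem_range_algebraMap_iff_fixed (F := k) (x : K)).2
    fun σ => congrArg Units.val (h σ)
  have hy₀ : y ≠ 0 := by
    rintro rfl
    exact x.ne_zero (hy.symm.trans (map_zero _))
  exact ⟨Units.mk0 y hy₀, Units.ext hy⟩

theorem rayToInvariants_surjective : Function.Surjective (m.rayToInvariants K) := by
  rintro ⟨b, hb⟩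
  let x : (m.induced K).rayGroup := Additive.toMul (b : Additive (m.induced K).rayGroup)
  obtain ⟨y, hy⟩ := exists_units_map_eq (k := k) (x := x.1) fun σ =>
    congrArg (fun z : (m.induced K).rayGroup => z.1) (hb σ)
  have hy_mem : y ∈ (m.unramifiedPart K).rayGroup := by
    rw [← m.map_mem_rayGroup_iff, hy]
    exact x.2
  exact ⟨Additive.ofMul ⟨y, hy_mem⟩, Subtype.ext (Additive.toMul.injective (Subtype.ext hy))⟩

variable {K} (hk : IsGlobalField k) (hK : IsGlobalField K)

theorem pullback_divHom (x : Additive (m.unramifiedPart K).rayGroup) :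
    m.pullback K (fun v => ramificationIndex K v) ((m.unramifiedPart K).divHom hk x) =
      invariantsMap (m.divRepHom hK ≫ m.principalInclusion K) (m.rayToInvariants K x) := by
  refine invariants_ext fun w => ?_
  let y : (m.induced K).rayGroup := ⟨_, (m.map_mem_rayGroup_iff x.toMul.1).2 x.toMul.2⟩
  change _ = ((m.induced K).divHom hK (Additive.ofMul y)).1.1 w
  by_cases hw : Sum.inl w ∈ placesOver K S
  · rw [((m.induced K).divHom hK _).1.2 w (Or.inl hw)]
    exact m.coeff_eq_zero _ (Or.inl (w.inl_mem_placesOver.1 hw))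
  · rw [divHom_apply_of_notMem _ _ _ hw, coeff_pullback,
      divHom_apply_of_notMem _ _ _ (w.inl_mem_placesOver.not.1 hw),
      FinitePlace.ramificationIndex_eq, ← FinitePlace.ord_map]
    rfl

include hk

theorem map_principalDivisors_eq :
    (m.unramifiedPart K).principalDivisors.map (m.pullback K fun v => ramificationIndex K v) =
      (LinearMap.range (invariantsMap
        (m.divRepHom hK ≫ m.principalInclusion K))).toAddSubgroup := by
  ext D
  constructor
  · rintro ⟨n, hn, rfl⟩
    obtain ⟨x, hx⟩ := (m.unramifiedPart K).divHom_surjective hk ⟨n, hn⟩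
    exact ⟨m.rayToInvariants K x, by rw [← m.pullback_divHom hk hK, hx]⟩
  · rintro ⟨b, rfl⟩
    obtain ⟨x, rfl⟩ := m.rayToInvariants_surjective K b
    exact ⟨_, ((m.unramifiedPart K).divHom hk x).2, m.pullback_divHom hk hK x⟩

theorem index_principal_invariants :
    (LinearMap.range (invariantsMap
        (m.divRepHom hK ≫ m.principalInclusion K))).toAddSubgroup.index =
      Nat.card (m.unramifiedPart K).ClassGroup *
        (dvdSubgroup (m.ramificationFamily K)).index := by
  rw [← m.map_principalDivisors_eq hk hK,
    AddSubgroup.index_map_of_injective _ m.pullback_injective, index_range_pullback]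
  rfl

theorem finite_setOf_ramificationFamily_ne_one [Finite (m.induced K).ClassGroup]
    [Finite (H1 (m.unitRep K))] : {v | m.ramificationFamily K v ≠ 1}.Finite := by
  have hK : IsGlobalField K := .of_finiteDimensional hk
  have : Finite (m.classRep K) := inferInstanceAs (Finite (m.induced K).ClassGroup)
  refine finite_setOf_ne_one_of_index_dvdSubgroup _ (right_ne_zero_of_mul
    (a := Nat.card (m.unramifiedPart K).ClassGroup) ?_)
  rw [← m.index_principal_invariants hk hK,
    index_range_invariantsMap_comp (m.unitSequence_shortExact hK) (m.classSequence_shortExact K)]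
  exact mul_ne_zero Nat.card_pos.ne' Nat.card_pos.ne'

theorem card_fixedPoints_classGroup [Finite (m.induced K).ClassGroup]
    [Finite (H1 (m.unitRep K))] :
    Nat.card (FixedPoints.addSubgroup (K ≃ₐ[k] K) (m.induced K).ClassGroup) *
        Nat.card (H1 (m.unitRep K)) * Nat.card (LinearMap.range (m.H2Map K).hom) =
      Nat.card (m.unramifiedPart K).ClassGroup * (∏ᶠ v, m.ramificationFamily K v) *
        Nat.card (H2 (m.unitRep K)) * Nat.card (H1 (m.rayRep K)) := by
  have hK : IsGlobalField K := .of_finiteDimensional hk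
  have := m.subsingleton_H1_divisorRep (K := K)
  rw [← index_dvdSubgroup _ (m.finite_setOf_ramificationFamily_ne_one hk),
    ← m.index_principal_invariants hk hK]
  exact card_invariants_mul_eq (m.unitSequence_shortExact hK) (m.classSequence_shortExact K)

end SModulus

theorem cast_div_eq_of_mul_eq {a b c d e h i : ℕ} (hb : b ≠ 0) (hc : c ≠ 0) (hi : i ≠ 0)
    (heq : a * c * i = b * e * d * h) : (a / b : ℚ) = d / c * (e * h / i) := by
  have heq' : (a * c * i : ℚ) = b * e * d * h := by exact_mod_cast heq
  rw [div_mul_div_comm, div_eq_div_iff (by positivity) (by positivity)]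
  linear_combination heq'

end RayClass

open RayClass in
theorem theorem4p1 {k K : Type} [Field k] [Field K] [Algebra k K]
    (hk : IsGlobalField k) [FiniteDimensional k K] [IsGalois k K]
    (S : Set (Place k)) (hS_finite : S.Finite) (hS_nonempty : S.Nonempty)
    (hS_inf : ∀ v : NumberField.InfinitePlace k, Sum.inr v ∈ S)
    (m : SModulus S) :
    Finite (m.induced K).ClassGroup ∧
    Finite (m.unramifiedPart K).ClassGroup ∧
    Finite (groupCohomology.H1 (m.unitRep K)) ∧
    Finite (groupCohomology.H2 (m.unitRep K)) ∧
    Finite (groupCohomology.H1 (m.rayRep K)) ∧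
    {v : FinitePlace k | Sum.inl v ∉ S ∪ m.support ∧ ramificationIndex K v ≠ 1}.Finite ∧
    (Nat.card (FixedPoints.addSubgroup (K ≃ₐ[k] K) (m.induced K).ClassGroup) : ℚ) /
        (Nat.card (m.unramifiedPart K).ClassGroup : ℚ) =
      (Nat.card (groupCohomology.H2 (m.unitRep K)) : ℚ) /
          (Nat.card (groupCohomology.H1 (m.unitRep K)) : ℚ) *
        (((∏ᶠ (v : FinitePlace k) (_ : Sum.inl v ∉ S ∪ m.support), ramificationIndex K v : ℕ) : ℚ) *
            (Nat.card (groupCohomology.H1 (m.rayRep K)) : ℚ) /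
          (Nat.card (LinearMap.range (m.H2Map K).hom) : ℚ)) := by
  have hK : IsGlobalField K := .of_finiteDimensional hk
  have := hK.finite_infinitePlace
  have hSK := placesOver_nonempty (K := K) hS_nonempty
  have hSK_finite := placesOver_finite (K := K) hS_finite
  have hClK := (m.induced K).finite_classGroup hK hSK
  have hClk := (m.unramifiedPart K).finite_classGroup hk hS_nonempty
  have hH1 := m.finite_H1_unitRep hK hSK_finite
  have hH2 := m.finite_H2_unitRep hK hSK_finite
  have hT := m.finite_setOf_ramificationFamily_ne_one (K := K) hk
  refine ⟨hClK, hClk, hH1, hH2, m.finite_H1_rayRep hK hSK,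
    (hT.image Subtype.val).subset fun v hv => ⟨⟨v, hv.1⟩, hv.2, rfl⟩, ?_⟩
  have : Finite (LinearMap.range (m.H2Map K).hom) :=
    Finite.of_surjective _ (m.H2Map K).hom.surjective_rangeRestrict
  rw [← finprod_subtype_eq_finprod_cond]
  exact cast_div_eq_of_mul_eq Nat.card_pos.ne' Nat.card_pos.ne' Nat.card_pos.ne'
    (m.card_fixedPoints_classGroup hk)
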